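/- Let $\mu$ be a probability distribution on $\mathbb{R}$ with mean $0$ and variance $\sigma^2$, where $\sigma>0$, and suppose that there is $t_0>0$ such that $\int e^{ty}\,\mu(dy)<\infty$ for all $|t|\le t_0$. Then for every $K>0$ there is a constant $C>0$, depending only on $\mu$ and $K$, such that the following holds for every $n\ge 1$. If $X_1,\dots,X_n$ are i.i.d. random variables with distribution $\mu$ and $S_n=\sum_{i=1}^n X_i$, then for every $x$ with $0<x\le K n^{1/4}$ $$\frac{\mathbb{P}(S_n> x\sigma\sqrt n)}{1-\Phi(x)}=\exp\Big\{\frac{x^3\,\mathbb{E}X_1^3}{6\sigma^3\sqrt n}\Big\}\Big[1+\theta\Big(\frac{(1+x)^4}{n}+\frac{1+x}{\sqrt n}\Big)\Big]$$ for some real $\theta=\theta(n,x)$ with $|\theta|\le C$, where $\Phi$ is the standard normal distribution function. -/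

import Mathlib

open MeasureTheory ProbabilityTheory

/-!
The tail of `S = X₁ + ⋯ + Xₙ` is computed under an exponentially tilted law (Cramér's method) and
the Berry–Esseen theorem is applied there.

Let `ψ` be the cumulant generating function of `μ` and tilt by `h = x / (σ √n)`, so that the tilted
law has mean `m = ψ' h` and variance `v = ψ'' h`. This `h` solves the saddle point equation only to
first order, which suffices in the range `x = O(n ^ (1/4))` and avoids inverting `ψ'`. The change of
measure `iidSum_real_Ioi_eq` reads `P(S > b) = exp (n ψ h) * E[exp (-h S'); S' > b]`, with `S'` the
sum of `n` variables of the tilted law. An exponential integral over a half-line depends on the law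
only through its distribution function (`setIntegral_exp_eq_setIntegral_real_Ioc`), so Berry–Esseen
replaces `S'` by a normal variable with an error `O(exp (n ψ h - h b) / √n)`. The normal
integral is explicit; the result is `exp (n ψ h - n h m + n v h ^ 2 / 2) * (1 - Φ x')` with
`x' = (b - n m + n v h) / √(n v)` (`abs_iidSum_real_Ioi_sub_le`).

With `b = x σ √n` and the expansions of `ψ`, `ψ'`, `ψ''` at `0` (`exists_cgf_expansion`),
* the exponent is `n κ h ^ 3 / 6 + O(x ^ 4 / n)`, `κ` the third moment (`abs_exponent_sub_le`);
* `x' = x + O(x ^ 3 / n)` (`abs_endpoint_sub_le`), which costs a relative error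
  `O((1 + x) * x ^ 3 / n)` because the Gaussian tail at `x` is at least of order
  `exp (-x ^ 2 / 2) / (1 + x)` (`le_gaussianReal_real_Ioi`);
* by the same lower bound the Berry–Esseen error has relative size `O((1 + x) / √n)`.

These are combined in `abs_ratio_mul_exp_sub_one_le`. When `h` is not small, `x` and `n` are bounded
and a crude estimate suffices (`exists_abs_ratio_sub_one_le_of_lt`).

The Berry–Esseen theorem (`berry_esseen`) is proved by Stein's method and Bolthausen's induction on
the number of summands: the Stein solution of a piecewise linear approximation of an indicator has a
derivative whose increments are controlled by the probability that the sum of one summand less falls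
in a short interval, and the induction hypothesis bounds that probability.
-/

/-! ### Gaussian tails -/

lemma integrable_exp_neg_sq_half : Integrable (fun t : ℝ => Real.exp (-t ^ 2 / 2)) := by
  have := integrable_exp_neg_mul_sq (b := 1 / 2) (by norm_num)
  convert this using 2 with t
  ring_nf

lemma integral_exp_neg_sq_half : ∫ t : ℝ, Real.exp (-t ^ 2 / 2) = √(2 * Real.pi) := by
  have := integral_gaussian (1 / 2)
  rw [show Real.pi / (1 / 2) = 2 * Real.pi by ring] at this
  rw [← this]
  congr 1 with t
  ring_nf

lemma sqrt_two_pi_le_three : √(2 * Real.pi) ≤ 3 := by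
  rw [Real.sqrt_le_left (by norm_num)]
  have := Real.pi_lt_d2
  linarith

lemma one_le_sqrt_two_pi : 1 ≤ √(2 * Real.pi) := by
  rw [Real.one_le_sqrt]
  have := Real.pi_gt_three
  linarith

lemma setIntegral_Ioi_exp_neg_sq_half_le {x : ℝ} (hx : 0 ≤ x) :
    ∫ t in Set.Ioi x, Real.exp (-t ^ 2 / 2) ≤ 3 * Real.exp (-x ^ 2 / 2) := by
  have hi : Integrable (fun t : ℝ => Real.exp (-x ^ 2 / 2) * Real.exp (-(t - x) ^ 2 / 2)) :=
    (integrable_exp_neg_sq_half.comp_sub_right x).const_mul _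
  calc ∫ t in Set.Ioi x, Real.exp (-t ^ 2 / 2)
      ≤ ∫ t in Set.Ioi x, Real.exp (-x ^ 2 / 2) * Real.exp (-(t - x) ^ 2 / 2) := by
        refine setIntegral_mono_on integrable_exp_neg_sq_half.integrableOn hi.integrableOn
          measurableSet_Ioi fun t ht => ?_
        rw [← Real.exp_add]
        have : x < t := ht
        gcongr
        nlinarith
    _ ≤ ∫ t, Real.exp (-x ^ 2 / 2) * Real.exp (-(t - x) ^ 2 / 2) :=
        setIntegral_le_integral hi (ae_of_all _ fun t => by positivity)
    _ = Real.exp (-x ^ 2 / 2) * √(2 * Real.pi) := by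
        rw [integral_const_mul, integral_sub_right_eq_self (fun t : ℝ => Real.exp (-t ^ 2 / 2)) x,
          integral_exp_neg_sq_half]
    _ ≤ _ := by
        rw [mul_comm]
        gcongr
        exact sqrt_two_pi_le_three

lemma mul_setIntegral_Ioi_exp_neg_sq_half_le {x : ℝ} (hx : 0 ≤ x) :
    x * ∫ t in Set.Ioi x, Real.exp (-t ^ 2 / 2) ≤ Real.exp (-x ^ 2 / 2) := by
  have hd : ∀ t ∈ Set.Ici x, HasDerivAt (fun t : ℝ => -Real.exp (-t ^ 2 / 2))
      (t * Real.exp (-t ^ 2 / 2)) t := by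
    intro t _
    have h1 : HasDerivAt (fun t : ℝ => -t ^ 2 / 2) (-t) t :=
      ((hasDerivAt_pow 2 t).neg.div_const 2).congr_deriv (by norm_num; ring)
    exact h1.exp.neg.congr_deriv (by ring)
  have hlim : Filter.Tendsto (fun t : ℝ => -Real.exp (-t ^ 2 / 2)) Filter.atTop (nhds 0) := by
    rw [← neg_zero]
    refine Filter.Tendsto.neg (Real.tendsto_exp_atBot.comp ?_)
    refine Filter.Tendsto.atBot_div_const (by norm_num) ?_
    exact Filter.tendsto_neg_atTop_atBot.comp (Filter.tendsto_pow_atTop (by norm_num))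
  have hpos : ∀ t ∈ Set.Ioi x, 0 ≤ t * Real.exp (-t ^ 2 / 2) := fun t ht => by
    have : x < t := ht
    have : 0 ≤ t := by linarith
    positivity
  have hint := integrableOn_Ioi_deriv_of_nonneg' hd hpos hlim
  have hval := integral_Ioi_of_hasDerivAt_of_nonneg' hd hpos hlim
  rw [← integral_const_mul]
  calc ∫ t in Set.Ioi x, x * Real.exp (-t ^ 2 / 2)
      ≤ ∫ t in Set.Ioi x, t * Real.exp (-t ^ 2 / 2) := by
        refine setIntegral_mono_on (integrable_exp_neg_sq_half.const_mul x).integrableOn hint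
          measurableSet_Ioi fun t ht => ?_
        have : x < t := ht
        gcongr
    _ = _ := by rw [hval]; ring

lemma gaussianPDFReal_zero_one (t : ℝ) :
    gaussianPDFReal 0 1 t = (√(2 * Real.pi))⁻¹ * Real.exp (-t ^ 2 / 2) := by
  simp [gaussianPDFReal]

lemma gaussianReal_real_eq_setIntegral (s : Set ℝ) :
    (gaussianReal 0 1).real s = (√(2 * Real.pi))⁻¹ * ∫ t in s, Real.exp (-t ^ 2 / 2) := by
  rw [measureReal_def, gaussianReal_apply_eq_integral 0 one_ne_zero, ENNReal.toReal_ofReal]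
  · simp_rw [gaussianPDFReal_zero_one]
    rw [integral_const_mul]
  · exact integral_nonneg fun t => gaussianPDFReal_nonneg _ _ _

lemma gaussianReal_real_Ioc_le {a b : ℝ} (hab : a ≤ b) {M : ℝ}
    (hM : ∀ t ∈ Set.Ioc a b, Real.exp (-t ^ 2 / 2) ≤ M) :
    (gaussianReal 0 1).real (Set.Ioc a b) ≤ M * (b - a) := by
  rw [gaussianReal_real_eq_setIntegral]
  have h1 : ∫ t in Set.Ioc a b, Real.exp (-t ^ 2 / 2) ≤ ∫ t in Set.Ioc a b, M :=
    setIntegral_mono_on integrable_exp_neg_sq_half.integrableOn (by simp) measurableSet_Ioc hM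
  have h2 : ∫ t in Set.Ioc a b, M = M * (b - a) := by
    simp [hab, mul_comm]
  rw [h2] at h1
  have h3 : 0 ≤ ∫ t in Set.Ioc a b, Real.exp (-t ^ 2 / 2) := integral_nonneg fun t => by positivity
  refine le_trans ?_ h1
  exact mul_le_of_le_one_left h3 (inv_le_one_of_one_le₀ one_le_sqrt_two_pi)

lemma gaussianReal_real_Ioc_le_sub {a b : ℝ} (hab : a ≤ b) :
    (gaussianReal 0 1).real (Set.Ioc a b) ≤ b - a := by
  simpa using gaussianReal_real_Ioc_le hab (M := 1) fun t _ =>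
    Real.exp_le_one_iff.2 (by nlinarith [sq_nonneg t])

lemma one_sub_cdf_eq (ν : Measure ℝ) [IsProbabilityMeasure ν] (x : ℝ) :
    1 - cdf ν x = ν.real (Set.Ioi x) := by
  rw [cdf_eq_real, ← Set.compl_Iic, probReal_compl_eq_one_sub measurableSet_Iic]

lemma cdf_sub_cdf_eq (ν : Measure ℝ) [IsProbabilityMeasure ν] {a b : ℝ} (hab : a ≤ b) :
    cdf ν b - cdf ν a = ν.real (Set.Ioc a b) := by
  rw [cdf_eq_real, cdf_eq_real, ← measureReal_sdiff (Set.Iic_subset_Iic.2 hab) measurableSet_Iic,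
    Set.Iic_sdiff_Iic]

/-- A lower bound of the order of Mills' ratio, obtained by integrating the density over an interval
of length `1 / (1 + x)` only. -/
lemma le_gaussianReal_real_Ioi {x : ℝ} (hx : 0 ≤ x) :
    (√(2 * Real.pi))⁻¹ * Real.exp (-3 / 2) * (Real.exp (-x ^ 2 / 2) / (1 + x))
      ≤ (gaussianReal 0 1).real (Set.Ioi x) := by
  rw [gaussianReal_real_eq_setIntegral, mul_assoc]
  refine mul_le_mul_of_nonneg_left ?_ (by positivity)
  set d := 1 / (1 + x) with hd
  have hd0 : 0 < d := by positivity
  have hd1 : d ≤ 1 := by rw [hd, div_le_one (by positivity)]; linarith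
  have hxd : x * d ≤ 1 := by rw [hd, mul_one_div, div_le_one (by positivity)]; linarith
  calc Real.exp (-3 / 2) * (Real.exp (-x ^ 2 / 2) / (1 + x))
      = ∫ t in Set.Ioc x (x + d), Real.exp (-3 / 2 + -x ^ 2 / 2) := by
        simp [hd0.le, Real.exp_add]
        rw [hd]; field_simp
    _ ≤ ∫ t in Set.Ioc x (x + d), Real.exp (-t ^ 2 / 2) := by
        refine setIntegral_mono_on (by simp) integrable_exp_neg_sq_half.integrableOn
          measurableSet_Ioc fun t ht => ?_
        gcongr
        have h1 := ht.1
        have h2 := ht.2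
        nlinarith
    _ ≤ _ := by
        refine setIntegral_mono_set integrable_exp_neg_sq_half.integrableOn
          (ae_of_all _ fun t => by positivity) ?_
        exact (Set.Ioc_subset_Ioi_self).eventuallyLE

/-- As long as `x * |y - x|` stays bounded, the tails at `x` and `y` differ by at most `|y - x|`
times the order of the density at `x`. By `le_gaussianReal_real_Ioi` this is a relative error of order
`(1 + x) * |y - x|`. -/
lemma abs_gaussianReal_real_Ioi_sub_le {x y : ℝ} (hx : 0 ≤ x) :
    |(gaussianReal 0 1).real (Set.Ioi y) - (gaussianReal 0 1).real (Set.Ioi x)|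
      ≤ |y - x| * Real.exp (-x ^ 2 / 2 + x * |y - x|) := by
  have key : ∀ a b : ℝ, a ≤ b → b - a = |y - x| → (∀ t ∈ Set.Ioc a b, x - |y - x| ≤ t) →
      (gaussianReal 0 1).real (Set.Ioi a) - (gaussianReal 0 1).real (Set.Ioi b)
        ≤ |y - x| * Real.exp (-x ^ 2 / 2 + x * |y - x|) ∧
      0 ≤ (gaussianReal 0 1).real (Set.Ioi a) - (gaussianReal 0 1).real (Set.Ioi b) := by
    intro a b hab hd ht
    have e : (gaussianReal 0 1).real (Set.Ioi a) - (gaussianReal 0 1).real (Set.Ioi b)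
        = (gaussianReal 0 1).real (Set.Ioc a b) := by
      rw [← one_sub_cdf_eq, ← one_sub_cdf_eq, ← cdf_sub_cdf_eq _ hab]; ring
    rw [e]
    refine ⟨?_, measureReal_nonneg⟩
    rw [← hd, mul_comm]
    refine gaussianReal_real_Ioc_le hab fun t h => ?_
    have := ht t h
    rw [hd]
    gcongr
    nlinarith [sq_nonneg (t - x)]
  rcases le_total x y with h | h
  · obtain ⟨h1, h2⟩ := key x y h (abs_of_nonneg (by linarith)).symm
      (fun t ht => by have := ht.1; have := abs_nonneg (y - x); linarith)
    rw [abs_sub_comm, abs_of_nonneg h2]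
    exact h1
  · obtain ⟨h1, h2⟩ := key y x h (by rw [abs_of_nonpos (by linarith)]; ring)
      (fun t ht => by have := ht.1; rw [abs_of_nonpos (by linarith)]; linarith)
    rw [abs_of_nonneg h2]
    exact h1

/-! ### Stein's equation -/

/-- The solution `f` of Stein's equation `f' w - w * f w = h w - ∫ h dγ`, for the standard normal
law `γ`, that stays bounded. -/
noncomputable def steinSol (h : ℝ → ℝ) (x : ℝ) : ℝ :=
  Real.exp (x ^ 2 / 2) *
    ∫ t in Set.Iic x, (h t - ∫ y, h y ∂(gaussianReal 0 1)) * Real.exp (-t ^ 2 / 2)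

section Stein

variable {h : ℝ → ℝ} (hc : Continuous h) (h0 : ∀ x, 0 ≤ h x) (h1 : ∀ x, h x ≤ 1)
include hc h0 h1

lemma integrable_of_continuous_of_unit (ν : Measure ℝ) [IsFiniteMeasure ν] : Integrable h ν := by
  refine Integrable.of_bound hc.aestronglyMeasurable 1 (ae_of_all _ fun x => ?_)
  rw [Real.norm_eq_abs, abs_of_nonneg (h0 x)]
  exact h1 x

lemma abs_sub_gaussian_mean_le (x : ℝ) : |h x - ∫ y, h y ∂(gaussianReal 0 1)| ≤ 1 := by
  have e0 : 0 ≤ ∫ y, h y ∂(gaussianReal 0 1) := integral_nonneg h0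
  have e1 : ∫ y, h y ∂(gaussianReal 0 1) ≤ 1 := by
    have := integral_mono (integrable_of_continuous_of_unit hc h0 h1 (gaussianReal 0 1))
      (integrable_const 1) h1
    simpa using this
  rw [abs_le]
  constructor <;> linarith [h0 x, h1 x]

lemma integrable_sub_mean_mul_exp :
    Integrable fun t => (h t - ∫ y, h y ∂(gaussianReal 0 1)) * Real.exp (-t ^ 2 / 2) := by
  refine Integrable.bdd_mul (c := 1) integrable_exp_neg_sq_half ?_ (ae_of_all _ fun x => ?_)
  · exact (hc.sub continuous_const).aestronglyMeasurable
  · exact abs_sub_gaussian_mean_le hc h0 h1 x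

lemma integral_sub_mean_mul_exp :
    ∫ t, (h t - ∫ y, h y ∂(gaussianReal 0 1)) * Real.exp (-t ^ 2 / 2) = 0 := by
  have e : ∫ t, (h t - ∫ y, h y ∂(gaussianReal 0 1)) ∂(gaussianReal 0 1) = 0 := by
    rw [integral_sub (integrable_of_continuous_of_unit hc h0 h1 _) (integrable_const _)]
    simp
  rw [integral_gaussianReal_eq_integral_smul one_ne_zero] at e
  simp_rw [gaussianPDFReal_zero_one, smul_eq_mul, mul_assoc] at e
  rw [integral_const_mul] at e
  have := one_le_sqrt_two_pi
  rcases mul_eq_zero.1 e with e | e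
  · exact absurd e (by positivity)
  · simpa [mul_comm] using e

lemma abs_setIntegral_sub_mean_mul_exp_le (s : Set ℝ) :
    |∫ t in s, (h t - ∫ y, h y ∂(gaussianReal 0 1)) * Real.exp (-t ^ 2 / 2)|
      ≤ ∫ t in s, Real.exp (-t ^ 2 / 2) := by
  rw [← Real.norm_eq_abs]
  refine norm_integral_le_of_norm_le integrable_exp_neg_sq_half.integrableOn
    (ae_of_all _ fun t => ?_)
  rw [Real.norm_eq_abs, abs_mul, Real.abs_exp]
  exact mul_le_of_le_one_left (by positivity) (abs_sub_gaussian_mean_le hc h0 h1 t)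

/-- Both integrals representing the Stein solution, over `(-∞, x]` and over `(x, ∞)`, are available;
the one over the half-line pointing away from the origin is controlled by Mills' ratio. -/
lemma abs_steinSol_le (x : ℝ) :
    |steinSol h x| ≤ Real.exp (|x| ^ 2 / 2) * ∫ t in Set.Ioi |x|, Real.exp (-t ^ 2 / 2) := by
  rw [steinSol, abs_mul, Real.abs_exp, sq_abs]
  refine mul_le_mul_of_nonneg_left ?_ (by positivity)
  rcases le_total 0 x with hx | hx
  · rw [abs_of_nonneg hx]
    have e := intervalIntegral.integral_Iic_add_Ioi (b := x)
      (integrable_sub_mean_mul_exp hc h0 h1).integrableOn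
      (integrable_sub_mean_mul_exp hc h0 h1).integrableOn
    rw [integral_sub_mean_mul_exp hc h0 h1] at e
    rw [eq_neg_of_add_eq_zero_left e, abs_neg]
    exact abs_setIntegral_sub_mean_mul_exp_le hc h0 h1 _
  · rw [abs_of_nonpos hx]
    refine (abs_setIntegral_sub_mean_mul_exp_le hc h0 h1 _).trans (le_of_eq ?_)
    rw [← integral_comp_neg_Iic x (fun t : ℝ => Real.exp (-t ^ 2 / 2))]
    simp

lemma abs_steinSol_le_three (x : ℝ) : |steinSol h x| ≤ 3 := by
  refine (abs_steinSol_le hc h0 h1 x).trans ?_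
  calc Real.exp (|x| ^ 2 / 2) * ∫ t in Set.Ioi |x|, Real.exp (-t ^ 2 / 2)
      ≤ Real.exp (|x| ^ 2 / 2) * (3 * Real.exp (-|x| ^ 2 / 2)) := by
        gcongr; exact setIntegral_Ioi_exp_neg_sq_half_le (abs_nonneg x)
    _ = 3 := by
        rw [mul_left_comm, ← Real.exp_add]
        ring_nf; simp

lemma abs_mul_steinSol_le (x : ℝ) : |x * steinSol h x| ≤ 1 := by
  rw [abs_mul]
  calc |x| * |steinSol h x|
      ≤ |x| * (Real.exp (|x| ^ 2 / 2) * ∫ t in Set.Ioi |x|, Real.exp (-t ^ 2 / 2)) := by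
        gcongr; exact abs_steinSol_le hc h0 h1 x
    _ = Real.exp (|x| ^ 2 / 2) * (|x| * ∫ t in Set.Ioi |x|, Real.exp (-t ^ 2 / 2)) := by ring
    _ ≤ Real.exp (|x| ^ 2 / 2) * Real.exp (-|x| ^ 2 / 2) := by
        gcongr; exact mul_setIntegral_Ioi_exp_neg_sq_half_le (abs_nonneg x)
    _ = 1 := by
        rw [← Real.exp_add]
        ring_nf; simp

lemma hasDerivAt_steinSol (x : ℝ) :
    HasDerivAt (steinSol h) (x * steinSol h x + (h x - ∫ y, h y ∂(gaussianReal 0 1))) x := by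
  set F : ℝ → ℝ := fun t => (h t - ∫ y, h y ∂(gaussianReal 0 1)) * Real.exp (-t ^ 2 / 2) with hF
  have hFc : Continuous F := by fun_prop
  have hFi : Integrable F := integrable_sub_mean_mul_exp hc h0 h1
  have hI : HasDerivAt (fun x => ∫ t in Set.Iic x, F t) (F x) x := by
    have e : (fun x => ∫ t in Set.Iic x, F t) =
        fun x => (∫ t in Set.Iic 0, F t) + ∫ t in 0..x, F t := by
      ext x
      rw [← intervalIntegral.integral_Iic_sub_Iic hFi.integrableOn hFi.integrableOn]
      ring
    rw [e]
    exact (intervalIntegral.integral_hasDerivAt_right (hFc.intervalIntegrable _ _)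
      (hFc.stronglyMeasurableAtFilter _ _) hFc.continuousAt).const_add _
  have hE : HasDerivAt (fun x : ℝ => Real.exp (x ^ 2 / 2)) (Real.exp (x ^ 2 / 2) * x) x := by
    have h2 : HasDerivAt (fun t : ℝ => t ^ 2 / 2) x x :=
      ((hasDerivAt_pow 2 x).div_const 2).congr_deriv (by norm_num)
    exact h2.exp
  refine (hE.mul hI).congr_deriv ?_
  rw [hF, steinSol]
  have : Real.exp (x ^ 2 / 2) * Real.exp (-x ^ 2 / 2) = 1 := by
    rw [← Real.exp_add]; ring_nf; simp
  linear_combination (h x - ∫ y, h y ∂(gaussianReal 0 1)) * this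

lemma abs_deriv_steinSol_le (x : ℝ) : |deriv (steinSol h) x| ≤ 2 := by
  rw [(hasDerivAt_steinSol hc h0 h1 x).deriv]
  refine (abs_add_le _ _).trans ?_
  have := abs_mul_steinSol_le hc h0 h1 x
  have := abs_sub_gaussian_mean_le hc h0 h1 x
  linarith

lemma abs_steinSol_sub_le (x y : ℝ) : |steinSol h y - steinSol h x| ≤ 2 * |y - x| := by
  have := Convex.norm_image_sub_le_of_norm_deriv_le (f := steinSol h) (s := Set.univ) (C := 2)
    (fun x _ => (hasDerivAt_steinSol hc h0 h1 x).differentiableAt)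
    (fun x _ => abs_deriv_steinSol_le hc h0 h1 x) convex_univ (Set.mem_univ x) (Set.mem_univ y)
  simpa using this

lemma continuous_steinSol : Continuous (steinSol h) :=
  continuous_iff_continuousAt.2 fun x => (hasDerivAt_steinSol hc h0 h1 x).continuousAt

lemma continuous_deriv_steinSol : Continuous (deriv (steinSol h)) := by
  have : deriv (steinSol h) =
      fun x => x * steinSol h x + (h x - ∫ y, h y ∂(gaussianReal 0 1)) :=
    funext fun x => (hasDerivAt_steinSol hc h0 h1 x).deriv
  rw [this]
  have := continuous_steinSol hc h0 h1
  fun_prop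

/-- The increments of the derivative of the Stein solution, up to those of `h` itself. -/
lemma abs_deriv_steinSol_add_sub_le (w y : ℝ) :
    |deriv (steinSol h) (w + y) - deriv (steinSol h) w|
      ≤ |y| * (3 + 2 * |w|) + |h (w + y) - h w| := by
  rw [(hasDerivAt_steinSol hc h0 h1 _).deriv, (hasDerivAt_steinSol hc h0 h1 _).deriv]
  have e : (w + y) * steinSol h (w + y) + (h (w + y) - ∫ y, h y ∂(gaussianReal 0 1)) -
      (w * steinSol h w + (h w - ∫ y, h y ∂(gaussianReal 0 1)))
      = y * steinSol h (w + y) + w * (steinSol h (w + y) - steinSol h w) + (h (w + y) - h w) := by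
    ring
  rw [e]
  refine (abs_add_three _ _ _).trans ?_
  have e1 : |y * steinSol h (w + y)| ≤ |y| * 3 := by
    rw [abs_mul]; gcongr; exact abs_steinSol_le_three hc h0 h1 _
  have e2 : |w * (steinSol h (w + y) - steinSol h w)| ≤ |w| * (2 * |y|) := by
    rw [abs_mul]; gcongr
    simpa using abs_steinSol_sub_le hc h0 h1 w (w + y)
  linarith

end Stein

/-! ### Laws of sums of independent copies -/

/-- The `n`-fold convolution power of `ν`: the law of the sum of `n` independent variables of
law `ν`. -/
noncomputable def iidSum (ν : Measure ℝ) : ℕ → Measure ℝ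
  | 0 => Measure.dirac 0
  | n + 1 => ν.conv (iidSum ν n)

instance instIsProbabilityMeasureIidSum (ν : Measure ℝ) [IsProbabilityMeasure ν] (n : ℕ) :
    IsProbabilityMeasure (iidSum ν n) := by
  induction n with
  | zero => rw [iidSum]; infer_instance
  | succ n ih => rw [iidSum]; infer_instance

section

variable (ν : Measure ℝ) [IsProbabilityMeasure ν]

lemma lintegral_iidSum_succ (n : ℕ) {f : ℝ → ENNReal} (hf : Measurable f) :
    ∫⁻ s, f s ∂(iidSum ν (n + 1)) = ∫⁻ x, ∫⁻ t, f (x + t) ∂(iidSum ν n) ∂ν := by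
  rw [iidSum, Measure.lintegral_conv hf]

lemma integral_iidSum_succ (n : ℕ) {f : ℝ → ℝ} (hf : Integrable f (iidSum ν (n + 1))) :
    ∫ s, f s ∂(iidSum ν (n + 1)) = ∫ x, ∫ t, f (x + t) ∂(iidSum ν n) ∂ν :=
  integral_conv hf

lemma integral_iidSum_succ_of_bounded (n : ℕ) {f : ℝ → ℝ} (hf : Continuous f) {M : ℝ}
    (hM : ∀ x, |f x| ≤ M) :
    ∫ s, f s ∂(iidSum ν (n + 1)) = ∫ x, ∫ t, f (x + t) ∂(iidSum ν n) ∂ν :=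
  integral_iidSum_succ ν n (Integrable.of_bound hf.aestronglyMeasurable M (ae_of_all _ hM))

lemma iidSum_map_affine (a m : ℝ) (n : ℕ) :
    iidSum (ν.map fun y => a * (y - m)) n = (iidSum ν n).map fun s => a * (s - n * m) := by
  have hm : ∀ b c : ℝ, Measurable fun y : ℝ => b * (y - c) := fun b c => by fun_prop
  have : IsProbabilityMeasure (ν.map fun y => a * (y - m)) :=
    Measure.isProbabilityMeasure_map (hm a m).aemeasurable
  induction n with
  | zero => rw [iidSum, iidSum, Measure.map_dirac' (hm a _)]; simp
  | succ n ih =>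
    refine Measure.ext_of_lintegral _ fun f hf => ?_
    rw [lintegral_iidSum_succ _ n hf, ih, lintegral_map (by fun_prop) (hm a m),
      lintegral_map hf (hm _ _), lintegral_iidSum_succ ν n (by fun_prop)]
    refine lintegral_congr fun x => ?_
    rw [lintegral_map (by fun_prop) (hm _ _)]
    refine lintegral_congr fun t => ?_
    congr 1
    push_cast
    ring

/-- Exponential tilting commutes with taking convolution powers. -/
lemma iidSum_tilted {h : ℝ} (hi : Integrable (fun y => Real.exp (h * y)) ν) (n : ℕ) :
    iidSum (ν.tilted fun y => h * y) n =
      (iidSum ν n).withDensity fun s => ENNReal.ofReal (Real.exp (h * s - n * cgf id ν h)) := by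
  have hp : IsProbabilityMeasure (ν.tilted fun y => h * y) := isProbabilityMeasure_tilted hi
  have hM : ∫ y, Real.exp (h * y) ∂ν = Real.exp (cgf id ν h) := (exp_cgf hi).symm
  induction n with
  | zero =>
    refine Measure.ext_of_lintegral _ fun f hf => ?_
    rw [iidSum, iidSum, lintegral_withDensity_eq_lintegral_mul _ (by fun_prop) hf,
      lintegral_dirac' _ hf, lintegral_dirac' _ (by fun_prop)]
    simp
  | succ n ih =>
    refine Measure.ext_of_lintegral _ fun f hf => ?_
    rw [lintegral_iidSum_succ _ n hf, ih, lintegral_tilted, hM,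
      lintegral_withDensity_eq_lintegral_mul _ (by fun_prop) hf,
      lintegral_iidSum_succ ν n (by fun_prop)]
    refine lintegral_congr fun x => ?_
    rw [lintegral_withDensity_eq_lintegral_mul _ (by fun_prop) (by fun_prop),
      ← lintegral_const_mul _ (by fun_prop)]
    refine lintegral_congr fun t => ?_
    simp only [Pi.mul_apply]
    rw [← mul_assoc, ← Real.exp_sub, ← ENNReal.ofReal_mul (by positivity), ← Real.exp_add]
    have e : h * x - cgf id ν h + (h * t - n * cgf id ν h)
        = h * (x + t) - (n + 1 : ℕ) * cgf id ν h := by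
      push_cast
      ring
    rw [e]

/-- Change of measure for tail probabilities. -/
lemma iidSum_real_Ioi_eq {h : ℝ} (hi : Integrable (fun y => Real.exp (h * y)) ν) (n : ℕ) (b : ℝ) :
    (iidSum ν n).real (Set.Ioi b) = Real.exp (n * cgf id ν h) *
      ∫ s in Set.Ioi b, Real.exp (-h * s) ∂(iidSum (ν.tilted fun y => h * y) n) := by
  rw [iidSum_tilted ν hi, setIntegral_withDensity_eq_setIntegral_toReal_smul (by fun_prop)
    (ae_of_all _ fun _ => ENNReal.ofReal_lt_top) _ measurableSet_Ioi, ← integral_const_mul]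
  rw [← setIntegral_one_eq_measureReal]
  refine setIntegral_congr_fun measurableSet_Ioi fun s _ => ?_
  simp only [smul_eq_mul]
  rw [ENNReal.toReal_ofReal (by positivity), ← Real.exp_add, ← Real.exp_add, eq_comm,
    Real.exp_eq_one_iff]
  ring

lemma hasLaw_sum_iidSum {Ω : Type*} [MeasurableSpace Ω] (P : Measure Ω) [IsProbabilityMeasure P]
    (n : ℕ) (X : Fin n → Ω → ℝ) (hX : ∀ i, HasLaw (X i) ν P) (hind : iIndepFun X P) :
    HasLaw (fun ω => ∑ i, X i ω) (iidSum ν n) P := by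
  induction n with
  | zero => simpa [iidSum] using ⟨by fun_prop, by simp⟩
  | succ n ih =>
    have h1 := ih (fun i => X i.succ) (fun i => hX _) (hind.precomp (Fin.succ_injective n))
    have h2 : IndepFun (X 0) (fun ω => ∑ i : Fin n, X i.succ ω) P := by
      have := (hind.indepFun_finsetSum_of_notMem₀ (fun i => (hX i).aemeasurable)
        (s := Finset.univ.map (Fin.succEmb n)) (i := 0) (by simp)).symm
      convert! this using 1
      ext ω
      simp
    have h3 := h2.hasLaw_add (hX 0) h1
    rw [iidSum]
    convert! h3 using 1
    ext ω
    simp [Fin.sum_univ_succ]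

variable {ν}

lemma integrable_sq_iidSum (h2 : Integrable (fun y => y ^ 2) ν) (n : ℕ) :
    Integrable (fun s => s ^ 2) (iidSum ν n) := by
  have h1 : Integrable (fun y : ℝ => y) ν :=
    ((memLp_two_iff_integrable_sq (by fun_prop)).2 h2).integrable (by norm_num)
  induction n with
  | zero => rw [iidSum]; exact integrable_dirac (by simp)
  | succ n ih =>
    have ih1 : Integrable (fun y : ℝ => y) (iidSum ν n) :=
      ((memLp_two_iff_integrable_sq (by fun_prop)).2 ih).integrable (by norm_num)
    rw [iidSum, Measure.conv, integrable_map_measure (by fun_prop) (by fun_prop)]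
    have e : ((fun s : ℝ => s ^ 2) ∘ fun p : ℝ × ℝ => p.1 + p.2) =
        fun p => p.1 ^ 2 + 2 * (p.1 * p.2) + p.2 ^ 2 := by
      ext p; simp only [Function.comp]; ring
    rw [e]
    exact ((h2.comp_fst _).add ((h1.mul_prod ih1).const_mul 2)).add (ih.comp_snd _)

lemma integrable_id_iidSum (h2 : Integrable (fun y => y ^ 2) ν) (n : ℕ) :
    Integrable (fun s : ℝ => s) (iidSum ν n) :=
  ((memLp_two_iff_integrable_sq (by fun_prop)).2 (integrable_sq_iidSum h2 n)).integrable
    (by norm_num)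

lemma integral_id_iidSum (h2 : Integrable (fun y => y ^ 2) ν) (hm : ∫ y, y ∂ν = 0) (n : ℕ) :
    ∫ s, s ∂(iidSum ν n) = 0 := by
  have h1 : Integrable (fun y : ℝ => y) ν :=
    ((memLp_two_iff_integrable_sq (by fun_prop)).2 h2).integrable (by norm_num)
  induction n with
  | zero => simp [iidSum]
  | succ n ih =>
    rw [integral_iidSum_succ ν n (integrable_id_iidSum h2 (n + 1))]
    simp_rw [integral_add (integrable_const _) (integrable_id_iidSum h2 n), ih]
    simpa using hm

lemma integral_sq_iidSum (h2 : Integrable (fun y => y ^ 2) ν) (hm : ∫ y, y ∂ν = 0)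
    (hv : ∫ y, y ^ 2 ∂ν = 1) (n : ℕ) : ∫ s, s ^ 2 ∂(iidSum ν n) = n := by
  induction n with
  | zero => simp [iidSum]
  | succ n ih =>
    rw [integral_iidSum_succ ν n (integrable_sq_iidSum h2 (n + 1))]
    have e : ∀ x : ℝ, ∫ t, (x + t) ^ 2 ∂(iidSum ν n) = x ^ 2 + n := by
      intro x
      have : ∀ t : ℝ, (x + t) ^ 2 = x ^ 2 + 2 * x * t + t ^ 2 := fun t => by ring
      simp_rw [this]
      have i1 := (integrable_id_iidSum h2 n).const_mul (2 * x)
      have i0 : Integrable (fun t : ℝ => x ^ 2 + 2 * x * t) (iidSum ν n) :=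
        (integrable_const _).add i1
      rw [integral_add i0 (integrable_sq_iidSum h2 n), integral_add (integrable_const _) i1,
        integral_const_mul, integral_id_iidSum h2 hm, ih]
      simp
    simp_rw [e]
    rw [integral_add h2 (integrable_const _), hv]
    simp [add_comm]

lemma integral_abs_iidSum_le (h2 : Integrable (fun y => y ^ 2) ν) (hm : ∫ y, y ∂ν = 0)
    (hv : ∫ y, y ^ 2 ∂ν = 1) (n : ℕ) : ∫ s, |s| ∂(iidSum ν n) ≤ √n := by
  refine Real.le_sqrt_of_sq_le ?_
  have hL : MemLp (fun s : ℝ => |s|) 2 (iidSum ν n) :=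
    ((memLp_two_iff_integrable_sq (by fun_prop)).2 (integrable_sq_iidSum h2 n)).abs
  have e := variance_eq_sub hL
  have := variance_nonneg (fun s : ℝ => |s|) (iidSum ν n)
  simp only [Pi.pow_apply, sq_abs] at e
  rw [integral_sq_iidSum h2 hm hv] at e
  linarith

/-- By symmetry of the summands, `E[S g(S)] = n E[X g(S)]`, where `X` is any one of them. -/
lemma integral_mul_iidSum (h2 : Integrable (fun y => y ^ 2) ν) (n : ℕ) {g : ℝ → ℝ}
    (hg : Continuous g) {M : ℝ} (hM : ∀ x, |g x| ≤ M) :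
    ∫ s, s * g s ∂(iidSum ν (n + 1)) = (n + 1) * ∫ x, x * ∫ t, g (x + t) ∂(iidSum ν n) ∂ν := by
  have h1 : Integrable (fun y : ℝ => y) ν :=
    ((memLp_two_iff_integrable_sq (by fun_prop)).2 h2).integrable (by norm_num)
  have hbdd : ∀ (ρ : Measure ℝ) [IsProbabilityMeasure ρ] (x : ℝ),
      Integrable (fun t => g (x + t)) ρ := fun ρ _ x =>
    Integrable.of_bound (by fun_prop) M (ae_of_all _ fun t => hM _)
  have hmul : ∀ (ρ : Measure ℝ), Integrable (fun t : ℝ => t) ρ → ∀ x : ℝ,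
      Integrable (fun t => t * g (x + t)) ρ := fun ρ hρ x =>
    hρ.mul_bdd (c := M) (by fun_prop) (ae_of_all _ fun t => hM _)
  induction n generalizing g with
  | zero => simp [iidSum]
  | succ n ih =>
    have hS : Integrable (fun s => s * g s) (iidSum ν (n + 2)) := by
      simpa using hmul _ (integrable_id_iidSum h2 (n + 2)) 0
    have hF : Continuous fun x => ∫ s, g (x + s) ∂(iidSum ν (n + 1)) := by
      refine continuous_of_dominated (bound := fun _ => M) (fun x => by fun_prop)
        (fun x => ae_of_all _ fun t => hM _) (integrable_const _) (ae_of_all _ fun t => by fun_prop)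
    have hFb : ∀ x, |∫ s, g (x + s) ∂(iidSum ν (n + 1))| ≤ M := fun x => by
      simpa using norm_integral_le_of_norm_le_const (μ := iidSum ν (n + 1))
        (f := fun s => g (x + s)) (ae_of_all _ fun t => hM _)
    have hFn : Continuous fun x => ∫ s, g (x + s) ∂(iidSum ν n) := by
      refine continuous_of_dominated (bound := fun _ => M) (fun x => by fun_prop)
        (fun x => ae_of_all _ fun t => hM _) (integrable_const _) (ae_of_all _ fun t => by fun_prop)
    have hFbn : ∀ x, |∫ s, g (x + s) ∂(iidSum ν n)| ≤ M := fun x => by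
      simpa using norm_integral_le_of_norm_le_const (μ := iidSum ν n)
        (f := fun s => g (x + s)) (ae_of_all _ fun t => hM _)
    have hprod : Integrable (fun p : ℝ × ℝ => p.2 * ∫ t, g (p.1 + p.2 + t) ∂(iidSum ν n))
        (ν.prod ν) := by
      refine (h1.comp_snd ν).mul_bdd (c := M) ?_ (ae_of_all _ fun p => hFbn _)
      exact (hFn.comp (by fun_prop : Continuous fun p : ℝ × ℝ => p.1 + p.2)).aestronglyMeasurable
    have hIH : ∀ x, ∫ s, s * g (x + s) ∂(iidSum ν (n + 1)) =
        (n + 1) * ∫ y, y * ∫ t, g (x + y + t) ∂(iidSum ν n) ∂ν := fun x => by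
      have := ih (g := fun s => g (x + s)) (by fun_prop) (fun s => hM _)
        (fun ρ _ y => Integrable.of_bound (by fun_prop) M (ae_of_all _ fun t => hM _))
        (fun ρ hρ y => hρ.mul_bdd (c := M) (by fun_prop) (ae_of_all _ fun t => hM _))
      simpa only [add_assoc] using this
    have hsplit : ∀ x, ∫ s, (x + s) * g (x + s) ∂(iidSum ν (n + 1)) =
        x * (∫ s, g (x + s) ∂(iidSum ν (n + 1))) +
          (n + 1) * ∫ y, y * ∫ t, g (x + y + t) ∂(iidSum ν n) ∂ν := fun x => by
      simp_rw [add_mul x]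
      rw [integral_add ((hbdd _ x).const_mul x) (hmul _ (integrable_id_iidSum h2 _) x),
        integral_const_mul, hIH]
    rw [integral_iidSum_succ ν (n + 1) hS]
    simp_rw [hsplit]
    rw [integral_add (h1.mul_bdd (c := M) hF.aestronglyMeasurable (ae_of_all _ hFb))
      (hprod.integral_prod_left.const_mul _), integral_const_mul]
    have hswap : ∫ x, ∫ y, y * ∫ t, g (x + y + t) ∂(iidSum ν n) ∂ν ∂ν =
        ∫ y, y * ∫ s, g (y + s) ∂(iidSum ν (n + 1)) ∂ν := by
      rw [integral_integral_swap hprod]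
      refine integral_congr_ae (ae_of_all _ fun y => ?_)
      simp only
      rw [integral_const_mul, integral_iidSum_succ_of_bounded ν n (f := fun s => g (y + s))
        (by fun_prop) (fun s => hM _)]
      congr 1
      refine integral_congr_ae (ae_of_all _ fun x => ?_)
      simp only
      refine integral_congr_ae (ae_of_all _ fun t => ?_)
      simp only
      congr 1
      ring
    rw [hswap]
    push_cast
    ring

end

/-! ### The Berry–Esseen theorem -/

/-- The piecewise linear function equal to `1` on `(-∞, z]` and to `0` on `[z + ε, ∞)`. -/
noncomputable def ramp (z ε x : ℝ) : ℝ := max 0 (min 1 ((z + ε - x) / ε))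

lemma continuous_ramp (z ε : ℝ) : Continuous (ramp z ε) := by
  unfold ramp; fun_prop

lemma ramp_nonneg (z ε x : ℝ) : 0 ≤ ramp z ε x := le_max_left _ _

lemma ramp_le_one (z ε x : ℝ) : ramp z ε x ≤ 1 := max_le zero_le_one (min_le_left _ _)

lemma ramp_eq_one {z ε x : ℝ} (hε : 0 < ε) (hx : x ≤ z) : ramp z ε x = 1 := by
  have : 1 ≤ (z + ε - x) / ε := by rw [le_div_iff₀ hε]; linarith
  simp [ramp, this]

lemma ramp_eq_zero {z ε x : ℝ} (hε : 0 < ε) (hx : z + ε ≤ x) : ramp z ε x = 0 := by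
  have : (z + ε - x) / ε ≤ 0 := div_nonpos_of_nonpos_of_nonneg (by linarith) hε.le
  simp [ramp, min_le_of_right_le this]

lemma abs_ramp_sub_le {z ε : ℝ} (hε : 0 < ε) (x y : ℝ) :
    |ramp z ε x - ramp z ε y| ≤ |x - y| / ε := by
  have h1 : |ramp z ε x - ramp z ε y|
      ≤ |min 1 ((z + ε - x) / ε) - min 1 ((z + ε - y) / ε)| := by
    simpa [ramp, max_comm] using
      abs_max_sub_max_le_abs (min 1 ((z + ε - x) / ε)) (min 1 ((z + ε - y) / ε)) 0
  refine h1.trans ((abs_min_sub_min_le_max _ _ _ _).trans ?_)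
  rw [← sub_div, abs_div, abs_of_pos hε]
  simp only [sub_self, abs_zero]
  rw [max_eq_right (by positivity), abs_sub_comm x y]
  ring_nf
  rfl

lemma abs_ramp_add_sub_le {z ε : ℝ} (hε : 0 < ε) {y r : ℝ} (hy : |y| ≤ r) (w : ℝ) :
    |ramp z ε (w + y) - ramp z ε w|
      ≤ (Set.Ioc (z - r) (z + ε + r)).indicator (fun _ => min 1 (r / ε)) w := by
  have hy' := abs_le.1 hy
  by_cases hw : w ∈ Set.Ioc (z - r) (z + ε + r)
  · rw [Set.indicator_of_mem hw]
    refine le_min ?_ ((abs_ramp_sub_le hε _ _).trans ?_)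
    · rw [abs_le]
      constructor <;> linarith [ramp_nonneg z ε w, ramp_nonneg z ε (w + y), ramp_le_one z ε w,
        ramp_le_one z ε (w + y)]
    · rw [add_sub_cancel_left]; gcongr
  · rw [Set.indicator_of_notMem hw]
    rw [Set.mem_Ioc, not_and_or, not_lt, not_le] at hw
    rcases hw with hw | hw
    · rw [ramp_eq_one hε (by linarith), ramp_eq_one hε (by linarith [abs_nonneg y])]; simp
    · rw [ramp_eq_zero hε (by linarith), ramp_eq_zero hε (by linarith [abs_nonneg y])]; simp

/-- A bound, over all `|y| ≤ r`, for the increment from `w` to `w + y` of the derivative of the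
Stein solution attached to `ramp z ε`. -/
noncomputable def steinIncr (z ε r w : ℝ) : ℝ :=
  r * (3 + 2 * |w|) + (Set.Ioc (z - r) (z + ε + r)).indicator (fun _ => min 1 (r / ε)) w

lemma abs_deriv_steinSol_ramp_sub_le {z ε : ℝ} (hε : 0 < ε) {y r : ℝ} (hy : |y| ≤ r) (w : ℝ) :
    |deriv (steinSol (ramp z ε)) (w + y) - deriv (steinSol (ramp z ε)) w| ≤ steinIncr z ε r w := by
  refine (abs_deriv_steinSol_add_sub_le (continuous_ramp z ε) (ramp_nonneg z ε) (ramp_le_one z ε)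
    w y).trans ?_
  unfold steinIncr
  gcongr
  exact abs_ramp_add_sub_le hε hy w

lemma abs_steinSol_ramp_taylor_le {z ε : ℝ} (hε : 0 < ε) (w y : ℝ) :
    |steinSol (ramp z ε) (w + y) - steinSol (ramp z ε) w - y * deriv (steinSol (ramp z ε)) w|
      ≤ |y| * steinIncr z ε |y| w := by
  set f := steinSol (ramp z ε) with hf
  have hd : ∀ x, HasDerivAt f (deriv f x) x := fun x =>
    (hasDerivAt_steinSol (continuous_ramp z ε) (ramp_nonneg z ε)
      (ramp_le_one z ε) x).differentiableAt.hasDerivAt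
  have hd2 : ∀ u, HasDerivAt (fun u => f (w + u) - u * deriv f w)
      (deriv f (w + u) - deriv f w) u := fun u => by
    have h1 := (hd (w + u)).comp_const_add w u
    exact (h1.sub ((hasDerivAt_id u).mul_const (deriv f w))).congr_deriv (by ring)
  have := Convex.norm_image_sub_le_of_norm_hasDerivWithin_le
    (f := fun u => f (w + u) - u * deriv f w) (s := Set.Icc (-|y|) |y|)
    (C := steinIncr z ε |y| w) (x := 0) (y := y)
    (fun u _ => (hd2 u).hasDerivWithinAt)
    (fun u hu => abs_deriv_steinSol_ramp_sub_le hε (abs_le.2 hu) w) (convex_Icc _ _)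
    (by simp) ⟨neg_abs_le y, le_abs_self y⟩
  simp only [add_zero, zero_mul, sub_zero, Real.norm_eq_abs] at this
  rw [mul_comm |y|]
  convert this using 2
  ring

section BerryEsseen

variable {ν : Measure ℝ} [IsProbabilityMeasure ν]

/-- A Berry–Esseen bound `D` for `n` summands bounds the probability of a short interval, on the
scale `√(n + 1)` of the next sum; the factor `2` bounds `√(n + 1) / √n`. -/
lemma iidSum_real_Ioc_le {n : ℕ} (hn : 1 ≤ n) {D : ℝ}
    (hD : ∀ z, |(iidSum ν n).real (Set.Iic (z * √n)) - cdf (gaussianReal 0 1) z| ≤ D)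
    {a b : ℝ} (hab : a ≤ b) :
    (iidSum ν n).real {t | t / √(n + 1 : ℝ) ∈ Set.Ioc a b} ≤ 2 * (b - a) + 2 * D := by
  have hn0 : (1 : ℝ) ≤ n := by exact_mod_cast hn
  have hs : 0 < √(n : ℝ) := Real.sqrt_pos.2 (by linarith)
  have hS : 0 < √(n + 1 : ℝ) := Real.sqrt_pos.2 (by linarith)
  set q := √(n + 1 : ℝ) / √(n : ℝ) with hq
  have hq0 : 0 < q := by positivity
  have hq2 : q ≤ 2 := by
    rw [hq, div_le_iff₀ hs, Real.sqrt_le_left (by positivity), mul_pow, Real.sq_sqrt (by linarith)]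
    linarith
  have hqs : q * √(n : ℝ) = √(n + 1 : ℝ) := by rw [hq]; field_simp
  have e : {t | t / √(n + 1 : ℝ) ∈ Set.Ioc a b} =
      Set.Iic (b * q * √(n : ℝ)) \ Set.Iic (a * q * √(n : ℝ)) := by
    ext t
    rw [Set.Iic_sdiff_Iic]
    simp only [Set.mem_ofPred_eq, Set.mem_Ioc, mul_assoc, hqs]
    rw [lt_div_iff₀ hS, div_le_iff₀ hS]
  have habq : a * q ≤ b * q := by gcongr
  rw [e, measureReal_sdiff (Set.Iic_subset_Iic.2 (by gcongr)) measurableSet_Iic]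
  have h1 := abs_le.1 (hD (a * q))
  have h2 := abs_le.1 (hD (b * q))
  have h3 := cdf_sub_cdf_eq (gaussianReal 0 1) habq
  have h4 := gaussianReal_real_Ioc_le_sub habq
  nlinarith

lemma integrable_abs_iidSum (h2 : Integrable (fun y => y ^ 2) ν) (n : ℕ) (c : ℝ) :
    Integrable (fun t : ℝ => |t / c|) (iidSum ν n) :=
  ((integrable_id_iidSum h2 n).div_const c).abs

lemma measurableSet_div_mem_Ioc (c a b : ℝ) : MeasurableSet {t : ℝ | t / c ∈ Set.Ioc a b} :=
  (measurable_id.div_const c) measurableSet_Ioc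

lemma steinIncr_comp_eq (z ε r c : ℝ) : (fun t : ℝ => steinIncr z ε r (t / c)) = fun t =>
    r * (3 + 2 * |t / c|) + ({t : ℝ | t / c ∈ Set.Ioc (z - r) (z + ε + r)}).indicator
      (fun _ => min 1 (r / ε)) t := by
  ext t
  simp only [steinIncr, Set.indicator_apply, Set.mem_ofPred_eq]

lemma integrable_steinIncr (h2 : Integrable (fun y => y ^ 2) ν) (n : ℕ) (z ε r c : ℝ) :
    Integrable (fun t => steinIncr z ε r (t / c)) (iidSum ν n) := by
  rw [steinIncr_comp_eq]
  exact (((integrable_const _).add ((integrable_abs_iidSum h2 n c).const_mul 2)).const_mul r).add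
    ((integrable_const _).indicator (measurableSet_div_mem_Ioc _ _ _))

lemma integral_steinIncr_le (h2 : Integrable (fun y => y ^ 2) ν) (hm : ∫ y, y ∂ν = 0)
    (hv : ∫ y, y ^ 2 ∂ν = 1) {n : ℕ} (hn : 1 ≤ n) {D : ℝ}
    (hD : ∀ z, |(iidSum ν n).real (Set.Iic (z * √n)) - cdf (gaussianReal 0 1) z| ≤ D)
    (z : ℝ) {ε r : ℝ} (hε : 0 < ε) (hr : 0 ≤ r) :
    ∫ t, steinIncr z ε r (t / √(n + 1 : ℝ)) ∂(iidSum ν n) ≤ r * (11 + 2 * D / ε) := by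
  have hn0 : (1 : ℝ) ≤ n := by exact_mod_cast hn
  have hS : 0 < √(n + 1 : ℝ) := Real.sqrt_pos.2 (by linarith)
  have hD0 : 0 ≤ D := (abs_nonneg _).trans (hD 0)
  have i1 := (integrable_abs_iidSum h2 n √(n + 1 : ℝ)).const_mul 2
  have i2 : Integrable (fun t => r * (3 + 2 * |t / √(n + 1 : ℝ)|)) (iidSum ν n) :=
    ((integrable_const _).add i1).const_mul r
  have hms := measurableSet_div_mem_Ioc √(n + 1 : ℝ) (z - r) (z + ε + r)
  rw [steinIncr_comp_eq, integral_add i2 ((integrable_const _).indicator hms), integral_const_mul,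
    integral_add (integrable_const _) i1, integral_const_mul, integral_indicator hms,
    setIntegral_const]
  have e1 : ∫ t, |t / √(n + 1 : ℝ)| ∂(iidSum ν n) ≤ 1 := by
    simp_rw [abs_div, integral_div]
    rw [abs_of_pos hS, div_le_one hS]
    exact (integral_abs_iidSum_le h2 hm hv n).trans (Real.sqrt_le_sqrt (by linarith))
  have e2 := iidSum_real_Ioc_le hn hD (a := z - r) (b := z + ε + r) (by linarith)
  have e3 : (iidSum ν n).real {t | t / √(n + 1 : ℝ) ∈ Set.Ioc (z - r) (z + ε + r)} • min 1 (r / ε)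
      ≤ 6 * r + r * (2 * D / ε) := by
    rw [smul_eq_mul]
    have m0 : 0 ≤ min 1 (r / ε) := le_min zero_le_one (by positivity)
    have m1 : min 1 (r / ε) * ε ≤ r := by
      rw [← le_div_iff₀ hε]; exact min_le_right _ _
    have m2 : min 1 (r / ε) * r ≤ r := mul_le_of_le_one_left hr (min_le_left _ _)
    have m3 : min 1 (r / ε) * (2 * D) ≤ r * (2 * D / ε) := by
      calc min 1 (r / ε) * (2 * D) ≤ (r / ε) * (2 * D) := by gcongr; exact min_le_right _ _
        _ = _ := by ring
    nlinarith
  have e4 : ∫ t : ℝ, (3 : ℝ) ∂(iidSum ν n) = 3 := by simp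
  rw [e4]
  nlinarith

/-- One step of Bolthausen's argument: Stein's method bounds the error for a smoothed
indicator at `n + 1` summands through the Berry–Esseen error `D` at `n` summands. -/
lemma abs_integral_ramp_sub_le (h3 : Integrable (fun y => |y| ^ 3) ν)
    (h2 : Integrable (fun y => y ^ 2) ν) (hm : ∫ y, y ∂ν = 0) (hv : ∫ y, y ^ 2 ∂ν = 1)
    {n : ℕ} (hn : 1 ≤ n) {D : ℝ}
    (hD : ∀ z, |(iidSum ν n).real (Set.Iic (z * √n)) - cdf (gaussianReal 0 1) z| ≤ D)
    (z : ℝ) {ε : ℝ} (hε : 0 < ε) :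
    |∫ s, ramp z ε (s / √(n + 1 : ℝ)) ∂(iidSum ν (n + 1)) - ∫ y, ramp z ε y ∂(gaussianReal 0 1)|
      ≤ (∫ y, |y| ^ 3 ∂ν + 1) * (11 + 2 * D / ε) / √(n + 1 : ℝ) := by
  have hn0 : (1 : ℝ) ≤ n := by exact_mod_cast hn
  set R := √(n + 1 : ℝ) with hR
  have hS : 0 < R := Real.sqrt_pos.2 (by linarith)
  have hRR : R * R = n + 1 := Real.mul_self_sqrt (by linarith)
  have hD0 : 0 ≤ D := (abs_nonneg _).trans (hD 0)
  set Λ := 11 + 2 * D / ε with hΛ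
  have hΛ0 : 0 ≤ Λ := by positivity
  set f := steinSol (ramp z ε) with hf
  have hfc : Continuous f :=
    continuous_steinSol (continuous_ramp z ε) (ramp_nonneg z ε) (ramp_le_one z ε)
  have hfc' : Continuous (deriv f) :=
    continuous_deriv_steinSol (continuous_ramp z ε) (ramp_nonneg z ε) (ramp_le_one z ε)
  have hfb : ∀ x, |f x| ≤ 3 :=
    abs_steinSol_le_three (continuous_ramp z ε) (ramp_nonneg z ε) (ramp_le_one z ε)
  have hfb' : ∀ x, |deriv f x| ≤ 2 :=
    abs_deriv_steinSol_le (continuous_ramp z ε) (ramp_nonneg z ε) (ramp_le_one z ε)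
  have h1 : Integrable (fun y : ℝ => y) ν :=
    ((memLp_two_iff_integrable_sq (by fun_prop)).2 h2).integrable (by norm_num)
  set P := iidSum ν n with hP
  have ib : ∀ g : ℝ → ℝ, Continuous g → ∀ M, (∀ x, |g x| ≤ M) → ∀ x,
      Integrable (fun t => g ((x + t) / R)) P := fun g hg M hM x =>
    Integrable.of_bound (by fun_prop) M (ae_of_all _ fun t => hM _)
  have cb : ∀ g : ℝ → ℝ, Continuous g → ∀ M, (∀ x, |g x| ≤ M) →
      Continuous fun x => ∫ t, g ((x + t) / R) ∂P := fun g hg M hM =>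
    continuous_of_dominated (bound := fun _ => M) (fun x => by fun_prop)
      (fun x => ae_of_all _ fun t => hM _) (integrable_const _) (ae_of_all _ fun t => by fun_prop)
  have bb : ∀ g : ℝ → ℝ, Continuous g → ∀ M, (∀ x, |g x| ≤ M) → ∀ x,
      |∫ t, g ((x + t) / R) ∂P| ≤ M := fun g hg M hM x => by
    simpa using norm_integral_le_of_norm_le_const (μ := P)
      (f := fun t => g ((x + t) / R)) (ae_of_all _ fun t => hM _)
  have if0 : Integrable (fun t => f (t / R)) P := by simpa using ib f hfc 3 hfb 0
  have if1 : Integrable (fun t => deriv f (t / R)) P := by simpa using ib _ hfc' 2 hfb' 0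
  set A := ∫ t, deriv f (t / R) ∂P with hA
  set A0 := ∫ t, f (t / R) ∂P with hA0
  have hIncr : ∀ x : ℝ, ∫ t, steinIncr z ε |x / R| (t / R) ∂P ≤ |x / R| * Λ := fun x =>
    integral_steinIncr_le h2 hm hv hn hD z hε (abs_nonneg _)
  have hIncrI : ∀ x : ℝ, Integrable (fun t => steinIncr z ε |x / R| (t / R)) P := fun x =>
    integrable_steinIncr h2 n z ε _ R
  -- Replace `f'` at the full sum by `f'` at the sum without one summand.
  have hE1 : |∫ s, deriv f (s / R) ∂(iidSum ν (n + 1)) - A| ≤ Λ / R := by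
    rw [integral_iidSum_succ_of_bounded ν n (f := fun s => deriv f (s / R)) (by fun_prop)
      (fun s => hfb' _)]
    have e : ∫ x, ∫ t, deriv f ((x + t) / R) ∂P ∂ν - A =
        ∫ x, ((∫ t, deriv f ((x + t) / R) ∂P) - A) ∂ν := by
      rw [integral_sub (Integrable.of_bound (cb _ hfc' 2 hfb').aestronglyMeasurable 2
        (ae_of_all _ (bb _ hfc' 2 hfb'))) (integrable_const _)]
      simp
    rw [e]
    have i1 : Integrable (fun x : ℝ => |x| / R * Λ) ν := (h1.abs.div_const R).mul_const Λ
    have e1 : ∫ y, |y| ∂ν ≤ 1 := by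
      have i2 : Integrable (fun y : ℝ => 1 + y ^ 2) ν := (integrable_const 1).add h2
      have e2 : ∫ y, (1 + y ^ 2) / 2 ∂ν = 1 := by
        rw [integral_div, integral_add (integrable_const _) h2, hv]
        norm_num
      rw [← e2]
      refine integral_mono h1.abs (i2.div_const 2) fun y => ?_
      simp only
      nlinarith [sq_nonneg (|y| - 1), sq_abs y]
    calc |∫ x, ((∫ t, deriv f ((x + t) / R) ∂P) - A) ∂ν|
        ≤ ∫ x, |x| / R * Λ ∂ν := by
          rw [← Real.norm_eq_abs]
          refine norm_integral_le_of_norm_le i1 (ae_of_all _ fun x => ?_)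
          rw [hA, ← integral_sub (ib _ hfc' 2 hfb' x) if1]
          refine (norm_integral_le_of_norm_le (hIncrI x) (ae_of_all _ fun t => ?_)).trans
            ((hIncr x).trans (le_of_eq ?_))
          · have := abs_deriv_steinSol_ramp_sub_le (z := z) hε (le_refl |x / R|) (t / R)
            rwa [← add_div, add_comm t x] at this
          · rw [abs_div, abs_of_pos hS]
      _ = (∫ y, |y| ∂ν) / R * Λ := by rw [integral_mul_const, integral_div]
      _ ≤ 1 / R * Λ := by gcongr
      _ = Λ / R := by ring
  -- The same for `E[W f(W)]`, after isolating one summand and expanding `f`.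
  have hE2 : |∫ s, s / R * f (s / R) ∂(iidSum ν (n + 1)) - A| ≤ (∫ y, |y| ^ 3 ∂ν) * Λ / R := by
    have e0 : ∫ s, s / R * f (s / R) ∂(iidSum ν (n + 1)) =
        R * ∫ x, x * ∫ t, f ((x + t) / R) ∂P ∂ν := by
      have e1 : ∀ s, s / R * f (s / R) = (s * f (s / R)) / R := fun s => by ring
      simp_rw [e1]
      rw [integral_div, integral_mul_iidSum h2 n (g := fun s => f (s / R)) (by fun_prop)
        (fun s => hfb _), ← hRR, ← hP]
      field_simp
    have i0 : Integrable (fun x => x * ∫ t, f ((x + t) / R) ∂P) ν :=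
      h1.mul_bdd (c := 3) (cb _ hfc 3 hfb).aestronglyMeasurable (ae_of_all _ (bb _ hfc 3 hfb))
    have i1 : Integrable (fun x => x * A0 + x ^ 2 * (A / R)) ν :=
      (h1.mul_const _).add (h2.mul_const _)
    have i2 : Integrable (fun x => |x| ^ 3 * (Λ / (R * R))) ν := h3.mul_const _
    have e2 : R * ∫ x, x * ∫ t, f ((x + t) / R) ∂P ∂ν - A =
        R * ∫ x, (x * (∫ t, f ((x + t) / R) ∂P) - (x * A0 + x ^ 2 * (A / R))) ∂ν := by
      rw [integral_sub i0 i1, integral_add (h1.mul_const _) (h2.mul_const _), integral_mul_const,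
        integral_mul_const, hm, hv]
      field_simp
      ring
    rw [e0, e2, abs_mul, abs_of_pos hS]
    have e3 : |∫ x, (x * (∫ t, f ((x + t) / R) ∂P) - (x * A0 + x ^ 2 * (A / R))) ∂ν|
        ≤ ∫ x, |x| ^ 3 * (Λ / (R * R)) ∂ν := by
      rw [← Real.norm_eq_abs]
      refine norm_integral_le_of_norm_le i2 (ae_of_all _ fun x => ?_)
      have e4 : x * (∫ t, f ((x + t) / R) ∂P) - (x * A0 + x ^ 2 * (A / R)) =
          x * ∫ t, (f ((x + t) / R) - f (t / R) - x / R * deriv f (t / R)) ∂P := by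
        have i3 : Integrable (fun t => f ((x + t) / R) - f (t / R)) P := (ib _ hfc 3 hfb x).sub if0
        rw [integral_sub i3 (if1.const_mul _), integral_sub (ib _ hfc 3 hfb x) if0,
          integral_const_mul]
        ring
      rw [e4, Real.norm_eq_abs, abs_mul, ← Real.norm_eq_abs (∫ t, _ ∂P)]
      calc |x| * ‖∫ t, (f ((x + t) / R) - f (t / R) - x / R * deriv f (t / R)) ∂P‖
          ≤ |x| * ∫ t, |x / R| * steinIncr z ε |x / R| (t / R) ∂P := by
            gcongr
            refine norm_integral_le_of_norm_le ((hIncrI x).const_mul _) (ae_of_all _ fun t => ?_)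
            have := abs_steinSol_ramp_taylor_le (z := z) hε (t / R) (x / R)
            rwa [← add_div, add_comm t x] at this
        _ ≤ |x| * (|x / R| * (|x / R| * Λ)) := by
            rw [integral_const_mul]; gcongr; exact hIncr x
        _ = |x| ^ 3 * (Λ / (R * R)) := by
            rw [abs_div, abs_of_pos hS]; field_simp
    calc R * |∫ x, (x * (∫ t, f ((x + t) / R) ∂P) - (x * A0 + x ^ 2 * (A / R))) ∂ν|
        ≤ R * ∫ x, |x| ^ 3 * (Λ / (R * R)) ∂ν := by gcongr
      _ = _ := by rw [integral_mul_const]; field_simp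
  -- Stein's equation, integrated.
  have hstein : ∫ s, ramp z ε (s / R) ∂(iidSum ν (n + 1)) - ∫ y, ramp z ε y ∂(gaussianReal 0 1) =
      ∫ s, deriv f (s / R) ∂(iidSum ν (n + 1)) - ∫ s, s / R * f (s / R) ∂(iidSum ν (n + 1)) := by
    have e : ∀ s, ramp z ε (s / R) = (deriv f (s / R) - s / R * f (s / R)) +
        ∫ y, ramp z ε y ∂(gaussianReal 0 1) := fun s => by
      rw [(hasDerivAt_steinSol (continuous_ramp z ε) (ramp_nonneg z ε) (ramp_le_one z ε) _).deriv]
      ring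
    have i1 : Integrable (fun s => deriv f (s / R)) (iidSum ν (n + 1)) :=
      Integrable.of_bound (by fun_prop) 2 (ae_of_all _ fun t => hfb' _)
    have i2 : Integrable (fun s => s / R * f (s / R)) (iidSum ν (n + 1)) :=
      ((integrable_id_iidSum h2 (n + 1)).div_const R).mul_bdd (c := 3) (by fun_prop)
        (ae_of_all _ fun t => hfb _)
    have i3 : Integrable (fun s => deriv f (s / R) - s / R * f (s / R)) (iidSum ν (n + 1)) :=
      i1.sub i2
    rw [integral_congr_ae (ae_of_all _ e), integral_add i3 (integrable_const _),
      integral_sub i1 i2]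
    simp
  rw [hstein]
  have := abs_le.1 hE1
  have := abs_le.1 hE2
  have e : (∫ y, |y| ^ 3 ∂ν + 1) * Λ / R = (∫ y, |y| ^ 3 ∂ν) * Λ / R + Λ / R := by ring
  rw [e, abs_le]
  constructor <;> linarith

/-- Errors for smoothed indicators control errors for indicators, at the cost of the smoothing
length `ε`. -/
lemma abs_real_Iic_sub_cdf_le {Q : Measure ℝ} [IsProbabilityMeasure Q] {R ε η : ℝ} (hR : 0 < R)
    (hε : 0 < ε) (hη : ∀ z, |∫ s, ramp z ε (s / R) ∂Q - ∫ y, ramp z ε y ∂(gaussianReal 0 1)| ≤ η)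
    (z : ℝ) : |Q.real (Set.Iic (z * R)) - cdf (gaussianReal 0 1) z| ≤ ε + η := by
  have lower : ∀ (ρ : Measure ℝ) [IsProbabilityMeasure ρ] (c : ℝ), 0 < c → ∀ w,
      ρ.real (Set.Iic (w * c)) ≤ ∫ s, ramp w ε (s / c) ∂ρ := by
    intro ρ _ c hc w
    rw [← integral_indicator_one measurableSet_Iic]
    refine integral_mono ((integrable_const _).indicator measurableSet_Iic)
      (Integrable.of_bound (by have := continuous_ramp w ε; fun_prop) 1 (ae_of_all _ fun t => ?_))
      fun t => ?_
    · rw [Real.norm_eq_abs, abs_of_nonneg (ramp_nonneg _ _ _)]; exact ramp_le_one _ _ _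
    · by_cases ht : t ∈ Set.Iic (w * c)
      · rw [Set.indicator_of_mem ht, ramp_eq_one hε ((div_le_iff₀ hc).2 ht)]; rfl
      · rw [Set.indicator_of_notMem ht]; exact ramp_nonneg _ _ _
  have upper : ∀ (ρ : Measure ℝ) [IsProbabilityMeasure ρ] (c : ℝ), 0 < c → ∀ w,
      ∫ s, ramp w ε (s / c) ∂ρ ≤ ρ.real (Set.Iic ((w + ε) * c)) := by
    intro ρ _ c hc w
    rw [← integral_indicator_one measurableSet_Iic]
    refine integral_mono
      (Integrable.of_bound (by have := continuous_ramp w ε; fun_prop) 1 (ae_of_all _ fun t => ?_))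
      ((integrable_const _).indicator measurableSet_Iic) fun t => ?_
    · rw [Real.norm_eq_abs, abs_of_nonneg (ramp_nonneg _ _ _)]; exact ramp_le_one _ _ _
    · by_cases ht : t ∈ Set.Iic ((w + ε) * c)
      · rw [Set.indicator_of_mem ht]; exact ramp_le_one _ _ _
      · rw [Set.indicator_of_notMem ht]
        rw [Set.mem_Iic, not_le] at ht
        exact (ramp_eq_zero hε ((le_div_iff₀ hc).2 ht.le)).le
  have g1 := upper (gaussianReal 0 1) 1 one_pos z
  have g2 := lower (gaussianReal 0 1) 1 one_pos (z - ε)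
  simp only [mul_one, div_one, ← cdf_eq_real] at g1 g2
  have q1 := lower Q R hR z
  have q2 := upper Q R hR (z - ε)
  rw [sub_add_cancel] at q2
  have l1 := cdf_sub_cdf_eq (gaussianReal 0 1) (show z ≤ z + ε by linarith)
  have l2 := cdf_sub_cdf_eq (gaussianReal 0 1) (show z - ε ≤ z by linarith)
  have l3 := gaussianReal_real_Ioc_le_sub (show z ≤ z + ε by linarith)
  have l4 := gaussianReal_real_Ioc_le_sub (show z - ε ≤ z by linarith)
  have m1 := abs_le.1 (hη z)
  have m2 := abs_le.1 (hη (z - ε))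
  rw [abs_le]
  constructor <;> linarith

/-- The Berry–Esseen theorem, by Bolthausen's induction on the number of summands. -/
theorem berry_esseen (h3 : Integrable (fun y => |y| ^ 3) ν)
    (h2 : Integrable (fun y => y ^ 2) ν) (hm : ∫ y, y ∂ν = 0) (hv : ∫ y, y ^ 2 ∂ν = 1)
    {n : ℕ} (hn : 1 ≤ n) (z : ℝ) :
    |(iidSum ν n).real (Set.Iic (z * √n)) - cdf (gaussianReal 0 1) z|
      ≤ 76 * (∫ y, |y| ^ 3 ∂ν) / √n := by
  set ρ := ∫ y, |y| ^ 3 ∂ν with hρ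
  have hρ1 : 1 ≤ ρ := by
    have i1 : Integrable (fun y : ℝ => 1 / 3 + 2 / 3 * |y| ^ 3) ν :=
      (integrable_const _).add (h3.const_mul _)
    have := integral_mono h2 i1 (fun y => by
      have h0 := abs_nonneg y
      simp only
      rw [← sq_abs]
      nlinarith [mul_nonneg (sq_nonneg (|y| - 1)) (by linarith : 0 ≤ 2 * |y| + 1)])
    rw [hv, integral_add (integrable_const _) (h3.const_mul _), integral_const_mul] at this
    simp only [integral_const, probReal_univ, one_smul] at this
    linarith
  induction n, hn using Nat.le_induction generalizing z with
  | base =>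
    have a1 := measureReal_nonneg (μ := iidSum ν 1) (s := Set.Iic (z * √((1 : ℕ) : ℝ)))
    have a2 := measureReal_le_one (μ := iidSum ν 1) (s := Set.Iic (z * √((1 : ℕ) : ℝ)))
    have a3 := cdf_nonneg (gaussianReal 0 1) z
    have a4 := cdf_le_one (gaussianReal 0 1) z
    have a5 : 76 * ρ / √((1 : ℕ) : ℝ) = 76 * ρ := by simp
    rw [a5, abs_le]
    constructor <;> linarith
  | succ n hn ih =>
    have hn0 : (1 : ℝ) ≤ n := by exact_mod_cast hn
    have hs : 0 < √(n : ℝ) := Real.sqrt_pos.2 (by linarith)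
    push_cast
    set R := √(n + 1 : ℝ) with hR
    have hS : 0 < R := Real.sqrt_pos.2 (by linarith)
    have hq : R ≤ 2 * √(n : ℝ) := by
      rw [hR, Real.sqrt_le_left (by positivity), mul_pow, Real.sq_sqrt (by linarith)]
      linarith
    -- The constants close up: `16 + 2 * (11 + 4 * 76 / 16) = 76`.
    have hε : 0 < 16 * ρ / R := by positivity
    refine (abs_real_Iic_sub_cdf_le hS hε
      (fun w => abs_integral_ramp_sub_le h3 h2 hm hv hn ih w hε) z).trans ?_
    have e1 : 2 * (76 * ρ / √(n : ℝ)) / (16 * ρ / R) ≤ 19 := by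
      rw [div_le_iff₀ hε]
      have : 76 * ρ / √(n : ℝ) ≤ 76 * ρ / (R / 2) := by gcongr; linarith
      refine (mul_le_mul_of_nonneg_left this zero_le_two).trans (le_of_eq ?_)
      field_simp
      norm_num
    calc 16 * ρ / R + (ρ + 1) * (11 + 2 * (76 * ρ / √(n : ℝ)) / (16 * ρ / R)) / R
        ≤ 16 * ρ / R + (ρ + ρ) * (11 + 19) / R := by gcongr
      _ = 76 * ρ / R := by ring

end BerryEsseen

/-! ### Exponential integrals over half-lines -/

/-- Fubini's theorem for `e^{-τ y} = ∫_{w ≥ y} τ e^{-τ w} dw`. -/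
lemma setIntegral_exp_eq_setIntegral_real_Ioc (Q : Measure ℝ) [IsProbabilityMeasure Q] {τ : ℝ}
    (hτ : 0 < τ) (a : ℝ) :
    ∫ y in Set.Ioi a, Real.exp (-τ * y) ∂Q =
      ∫ w in Set.Ioi a, τ * Real.exp (-τ * w) * Q.real (Set.Ioc a w) := by
  set F : ℝ → ℝ → ℝ := fun y w => {p : ℝ × ℝ | p.1 ≤ p.2}.indicator
    (fun p => τ * Real.exp (-τ * p.2)) (y, w) with hF
  have hi : IntegrableOn (fun w => τ * Real.exp (-τ * w)) (Set.Ioi a) :=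
    (integrableOn_exp_mul_Ioi (by linarith) a).const_mul τ
  have hms : MeasurableSet {p : ℝ × ℝ | p.1 ≤ p.2} :=
    measurableSet_le measurable_fst measurable_snd
  have hFi : Integrable (Function.uncurry F) ((Q.restrict (Set.Ioi a)).prod
      (volume.restrict (Set.Ioi a))) :=
    (Integrable.comp_snd hi (Q.restrict (Set.Ioi a))).indicator hms
  have h1 : ∀ y ∈ Set.Ioi a, ∫ w in Set.Ioi a, F y w = Real.exp (-τ * y) := fun y hy => by
    have e : F y = (Set.Ici y).indicator fun w => τ * Real.exp (-τ * w) := by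
      ext w; simp [hF, Set.indicator_apply]
    have hy' : Set.Ioi a ∩ Set.Ici y = Set.Ici y :=
      Set.inter_eq_right.2 (Set.Ici_subset_Ioi.2 hy)
    rw [e, setIntegral_indicator measurableSet_Ici, hy', integral_Ici_eq_integral_Ioi,
      integral_const_mul, integral_exp_mul_Ioi (by linarith)]
    field_simp
  have h2 : ∀ w, ∫ y in Set.Ioi a, F y w ∂Q = τ * Real.exp (-τ * w) * Q.real (Set.Ioc a w) :=
    fun w => by
    have e : (fun y => F y w) = (Set.Iic w).indicator fun _ => τ * Real.exp (-τ * w) := by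
      ext y; simp [hF, Set.indicator_apply]
    rw [e, setIntegral_indicator measurableSet_Iic, Set.Ioi_inter_Iic, setIntegral_const,
      smul_eq_mul, mul_comm]
  rw [← setIntegral_congr_fun measurableSet_Ioi h1, integral_integral_swap hFi]
  simp_rw [h2]

/-- Laws that are close in Kolmogorov distance have close exponential integrals over a half-line,
with an error of the size of the integrand at the end point. -/
lemma abs_setIntegral_exp_sub_setIntegral_exp_le (Q G : Measure ℝ) [IsProbabilityMeasure Q]
    [IsProbabilityMeasure G] {D : ℝ} (hD : ∀ w, |Q.real (Set.Iic w) - cdf G w| ≤ D) {τ : ℝ}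
    (hτ : 0 < τ) (a : ℝ) :
    |∫ y in Set.Ioi a, Real.exp (-τ * y) ∂Q - ∫ y in Set.Ioi a, Real.exp (-τ * y) ∂G|
      ≤ Real.exp (-τ * a) * (2 * D) := by
  have hi : IntegrableOn (fun w => τ * Real.exp (-τ * w)) (Set.Ioi a) :=
    (integrableOn_exp_mul_Ioi (by linarith) a).const_mul τ
  have hmul : ∀ (ρ : Measure ℝ) [IsProbabilityMeasure ρ],
      IntegrableOn (fun w => τ * Real.exp (-τ * w) * ρ.real (Set.Ioc a w)) (Set.Ioi a) := by
    intro ρ _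
    refine Integrable.mul_bdd (c := 1) hi ?_ (ae_of_all _ fun w => ?_)
    · refine Measurable.aestronglyMeasurable (Monotone.measurable fun u w huw => ?_)
      exact measureReal_mono (Set.Ioc_subset_Ioc_right huw)
    · rw [Real.norm_eq_abs, abs_of_nonneg measureReal_nonneg]; exact measureReal_le_one
  rw [setIntegral_exp_eq_setIntegral_real_Ioc Q hτ, setIntegral_exp_eq_setIntegral_real_Ioc G hτ,
    ← integral_sub (hmul Q) (hmul G), ← Real.norm_eq_abs]
  have hb : ∀ᵐ w ∂(volume.restrict (Set.Ioi a)),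
      ‖τ * Real.exp (-τ * w) * Q.real (Set.Ioc a w) - τ * Real.exp (-τ * w) * G.real (Set.Ioc a w)‖
        ≤ τ * Real.exp (-τ * w) * (2 * D) := by
    refine (ae_restrict_iff' measurableSet_Ioi).2 (ae_of_all _ fun w hw => ?_)
    have hw' : a ≤ w := le_of_lt hw
    rw [← mul_sub, norm_mul, Real.norm_eq_abs, abs_of_pos (by positivity), Real.norm_eq_abs]
    gcongr
    rw [← cdf_sub_cdf_eq Q hw', ← cdf_sub_cdf_eq G hw']
    have h1 := abs_le.1 (hD a)
    have h2 := abs_le.1 (hD w)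
    rw [← cdf_eq_real] at h1 h2
    rw [abs_le]
    constructor <;> linarith
  refine (norm_integral_le_of_norm_le (Integrable.mul_const hi _) hb).trans (le_of_eq ?_)
  rw [integral_mul_const, integral_const_mul, integral_exp_mul_Ioi (by linarith)]
  field_simp

lemma setIntegral_exp_gaussianReal (τ a : ℝ) :
    ∫ y in Set.Ioi a, Real.exp (-τ * y) ∂(gaussianReal 0 1) =
      Real.exp (τ ^ 2 / 2) * (gaussianReal 0 1).real (Set.Ioi (a + τ)) := by
  rw [← integral_indicator measurableSet_Ioi, integral_gaussianReal_eq_integral_smul one_ne_zero,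
    gaussianReal_real_eq_setIntegral, ← integral_indicator measurableSet_Ioi,
    ← integral_add_right_eq_self _ (-τ), ← integral_const_mul, ← integral_const_mul]
  refine integral_congr_ae (ae_of_all _ fun y => ?_)
  simp only [gaussianPDFReal_zero_one, smul_eq_mul, Set.indicator_apply, Set.mem_Ioi]
  by_cases hy : a + τ < y
  · rw [if_pos hy, if_pos (by linarith), mul_assoc, mul_left_comm (Real.exp (τ ^ 2 / 2)),
      ← Real.exp_add, ← Real.exp_add]
    ring_nf
  · rw [if_neg hy, if_neg (by linarith)]; simp

/-- The Berry–Esseen theorem for a law with mean `m` and variance `v`. -/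
lemma berry_esseen_affine (ν : Measure ℝ) [IsProbabilityMeasure ν] {m v : ℝ} (hv0 : 0 < v)
    (h3 : Integrable (fun y => |y - m| ^ 3) ν) (h2 : Integrable (fun y => (y - m) ^ 2) ν)
    (hm : ∫ y, y - m ∂ν = 0) (hv : ∫ y, (y - m) ^ 2 ∂ν = v) {n : ℕ} (hn : 1 ≤ n) (w : ℝ) :
    |((iidSum ν n).map fun s => (√v)⁻¹ * (s - n * m) / √n).real (Set.Iic w)
        - cdf (gaussianReal 0 1) w| ≤ 76 * ((∫ y, |y - m| ^ 3 ∂ν) / √v ^ 3) / √n := by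
  have hs : 0 < √v := Real.sqrt_pos.2 hv0
  have hn0 : (1 : ℝ) ≤ n := by exact_mod_cast hn
  have hsn : 0 < √(n : ℝ) := Real.sqrt_pos.2 (by linarith)
  have hf : Measurable fun y : ℝ => (√v)⁻¹ * (y - m) := by fun_prop
  have hp : IsProbabilityMeasure (ν.map fun y => (√v)⁻¹ * (y - m)) :=
    Measure.isProbabilityMeasure_map hf.aemeasurable
  have e3 : ∀ y, |(√v)⁻¹ * (y - m)| ^ 3 = |y - m| ^ 3 / √v ^ 3 := fun y => by
    rw [abs_mul, abs_of_pos (inv_pos.2 hs)]; field_simp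
  have e2 : ∀ y, ((√v)⁻¹ * (y - m)) ^ 2 = (y - m) ^ 2 / v := fun y => by
    rw [mul_pow, inv_pow, Real.sq_sqrt hv0.le]; field_simp
  have key := berry_esseen (ν := ν.map fun y => (√v)⁻¹ * (y - m))
    (by
      rw [integrable_map_measure (by fun_prop) hf.aemeasurable]
      simp only [Function.comp_def, e3]
      exact h3.div_const _)
    (by
      rw [integrable_map_measure (by fun_prop) hf.aemeasurable]
      simp only [Function.comp_def, e2]
      exact h2.div_const _)
    (by
      rw [integral_map hf.aemeasurable (by fun_prop), integral_const_mul, hm, mul_zero])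
    (by
      rw [integral_map hf.aemeasurable (by fun_prop)]
      simp only [e2]
      rw [integral_div, hv, div_self hv0.ne'])
    hn w
  rw [integral_map hf.aemeasurable (by fun_prop), iidSum_map_affine,
    map_measureReal_apply (by fun_prop) measurableSet_Iic] at key
  rw [integral_congr_ae (ae_of_all _ e3), integral_div] at key
  have e : (fun s : ℝ => (√v)⁻¹ * (s - n * m) / √n) ⁻¹' Set.Iic w =
      (fun s => (√v)⁻¹ * (s - n * m)) ⁻¹' Set.Iic (w * √n) := by
    ext s
    rw [Set.mem_preimage, Set.mem_preimage, Set.mem_Iic, Set.mem_Iic, div_le_iff₀ hsn]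
  rwa [map_measureReal_apply (by fun_prop) measurableSet_Iic, e]

/-- The exponential integral of a sum of i.i.d. variables over a half-line, compared with its value
for the normal law with the same mean and variance. -/
lemma abs_setIntegral_exp_iidSum_sub_le (ν : Measure ℝ) [IsProbabilityMeasure ν] {m v : ℝ}
    (hv0 : 0 < v) (h3 : Integrable (fun y => |y - m| ^ 3) ν)
    (h2 : Integrable (fun y => (y - m) ^ 2) ν) (hm : ∫ y, y - m ∂ν = 0)
    (hv : ∫ y, (y - m) ^ 2 ∂ν = v) {n : ℕ} (hn : 1 ≤ n) {h : ℝ} (hh : 0 < h) (b : ℝ) :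
    |∫ s in Set.Ioi b, Real.exp (-h * s) ∂(iidSum ν n) -
        Real.exp (-(h * (n * m)) + n * v * h ^ 2 / 2) *
          (gaussianReal 0 1).real (Set.Ioi ((b - n * m + n * v * h) / (√v * √n)))|
      ≤ Real.exp (-h * b) * (2 * (76 * ((∫ y, |y - m| ^ 3 ∂ν) / √v ^ 3) / √n)) := by
  have hs : 0 < √v := Real.sqrt_pos.2 hv0
  have hn0 : (1 : ℝ) ≤ n := by exact_mod_cast hn
  have hsn : 0 < √(n : ℝ) := Real.sqrt_pos.2 (by linarith)
  have hvv : √v * √v = v := Real.mul_self_sqrt hv0.le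
  have hnn : √(n : ℝ) * √(n : ℝ) = n := Real.mul_self_sqrt (by linarith)
  set r := √v * √(n : ℝ) with hr
  have hr0 : 0 < r := by positivity
  have hrr : r * r = n * v := by rw [← hvv, ← hnn]; ring
  set φ : ℝ → ℝ := fun s => (√v)⁻¹ * (s - n * m) / √n with hφ
  have hφm : Measurable φ := by fun_prop
  have hφr : ∀ s, φ s = (s - n * m) / r := fun s => by rw [hφ, hr]; field_simp
  have hp : IsProbabilityMeasure ((iidSum ν n).map φ) :=
    Measure.isProbabilityMeasure_map hφm.aemeasurable
  have key := abs_setIntegral_exp_sub_setIntegral_exp_le ((iidSum ν n).map φ) (gaussianReal 0 1)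
    (berry_esseen_affine ν hv0 h3 h2 hm hv hn) (mul_pos hh hr0) ((b - n * m) / r)
  rw [setIntegral_exp_gaussianReal, setIntegral_map measurableSet_Ioi (by fun_prop)
    hφm.aemeasurable] at key
  have e1 : φ ⁻¹' Set.Ioi ((b - n * m) / r) = Set.Ioi b := by
    ext s
    rw [Set.mem_preimage, Set.mem_Ioi, hφr, div_lt_div_iff_of_pos_right hr0, Set.mem_Ioi]
    constructor <;> intro <;> linarith
  have e2 : ∀ s, Real.exp (-(h * r) * φ s) = Real.exp (h * (n * m)) * Real.exp (-h * s) :=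
    fun s => by
    rw [hφr, ← Real.exp_add]
    congr 1
    field_simp
    ring
  have e3 : (b - n * m) / r + h * r = (b - n * m + n * v * h) / r := by
    rw [← hrr]; field_simp
  have e4 : (h * r) ^ 2 / 2 = n * v * h ^ 2 / 2 := by rw [← hrr]; ring
  have e5 : Real.exp (-(h * r) * ((b - n * m) / r)) =
      Real.exp (h * (n * m)) * Real.exp (-h * b) := by
    rw [← Real.exp_add]
    congr 1
    field_simp
    ring
  rw [e1, e3, e4, e5] at key
  simp only [e2] at key
  rw [integral_const_mul] at key
  have e6 : Real.exp (-(h * (n * m)) + n * v * h ^ 2 / 2) * Real.exp (h * (n * m)) =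
      Real.exp (n * v * h ^ 2 / 2) := by
    rw [← Real.exp_add]; ring_nf
  rw [← e6, mul_assoc (Real.exp (h * (n * m))),
    mul_comm (Real.exp (-(h * (n * m)) + n * v * h ^ 2 / 2)), mul_assoc, ← mul_sub, abs_mul,
    Real.abs_exp] at key
  exact le_of_mul_le_mul_left key (Real.exp_pos _)

/-! ### Exponential tilting -/

/-- The tail of a sum of i.i.d. variables, computed under the law tilted by `h`. Here `m`, `v` and
`L` are the mean, the variance and the third absolute central moment of the tilted law. -/
lemma abs_iidSum_real_Ioi_sub_le (μ : Measure ℝ) [IsProbabilityMeasure μ] {h : ℝ} (hh : 0 < h)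
    (hmem : h ∈ interior (integrableExpSet id μ)) {m v L : ℝ} (hm : deriv (cgf id μ) h = m)
    (hv : iteratedDeriv 2 (cgf id μ) h = v) (hv0 : 0 < v)
    (hL : ∫ y, |y - m| ^ 3 ∂(μ.tilted fun y => h * y) ≤ L) {n : ℕ} (hn : 1 ≤ n) (b : ℝ) :
    |(iidSum μ n).real (Set.Ioi b) -
        Real.exp (n * cgf id μ h - h * (n * m) + n * v * h ^ 2 / 2) *
          (gaussianReal 0 1).real (Set.Ioi ((b - n * m + n * v * h) / (√v * √n)))|
      ≤ Real.exp (n * cgf id μ h - h * b) * (152 * (L / √v ^ 3) / √n) := by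
  have hi : Integrable (fun y => Real.exp (h * y)) μ :=
    interior_subset (s := integrableExpSet id μ) hmem
  have hp : IsProbabilityMeasure (μ.tilted fun y => h * y) := isProbabilityMeasure_tilted hi
  have hLp : ∀ p : NNReal, MemLp (fun y : ℝ => y - m) p (μ.tilted fun y => h * y) := fun p =>
    (memLp_tilted_mul (X := id) hmem p).sub (memLp_const m)
  have h1 : Integrable (fun y : ℝ => y) (μ.tilted fun y => h * y) :=
    (memLp_tilted_mul (X := id) hmem 1).integrable (by simp)
  have hmean : ∫ y, y ∂(μ.tilted fun y => h * y) = m := by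
    rw [← hm]; exact integral_tilted_mul_self (X := id) hmem
  have hvar : ∫ y, (y - m) ^ 2 ∂(μ.tilted fun y => h * y) = v := by
    have := variance_tilted_mul (X := id) hmem
    simp only [id] at this
    rw [variance_eq_integral (by fun_prop), hv] at this
    simp only [id, hmean] at this
    exact this
  have h2 : Integrable (fun y => (y - m) ^ 2) (μ.tilted fun y => h * y) :=
    (hLp 2).integrable_sq
  have h3 : Integrable (fun y => |y - m| ^ 3) (μ.tilted fun y => h * y) := by
    simpa using (hLp 3).integrable_norm_pow (p := 3) (by norm_num)
  have hmean0 : ∫ y, y - m ∂(μ.tilted fun y => h * y) = 0 := by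
    rw [integral_sub h1 (integrable_const _), hmean]; simp
  have key := abs_setIntegral_exp_iidSum_sub_le _ hv0 h3 h2 hmean0 hvar hn hh b
  rw [iidSum_real_Ioi_eq μ hi n b]
  have e1 : Real.exp (n * cgf id μ h - h * (n * m) + n * v * h ^ 2 / 2) =
      Real.exp (n * cgf id μ h) * Real.exp (-(h * (n * m)) + n * v * h ^ 2 / 2) := by
    rw [← Real.exp_add]; ring_nf
  have e2 : Real.exp (n * cgf id μ h - h * b) =
      Real.exp (n * cgf id μ h) * Real.exp (-h * b) := by
    rw [← Real.exp_add]; ring_nf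
  rw [e1, e2, mul_assoc (Real.exp (n * cgf id μ h)), mul_assoc (Real.exp (n * cgf id μ h)),
    ← mul_sub, abs_mul, Real.abs_exp]
  refine mul_le_mul_of_nonneg_left (key.trans ?_) (Real.exp_pos _).le
  have hs : 0 < √v := Real.sqrt_pos.2 hv0
  calc Real.exp (-h * b) * (2 * (76 * ((∫ y, |y - m| ^ 3 ∂(μ.tilted fun y => h * y)) / √v ^ 3) / √n))
      ≤ Real.exp (-h * b) * (2 * (76 * (L / √v ^ 3) / √n)) := by gcongr
    _ = _ := by ring

/-! ### Expansion of the cumulant generating function -/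

/-- Integrating a bound of order `u ^ k` on a derivative gives one of order `u ^ (k + 1)`. -/
lemma abs_le_mul_pow_succ_of_hasDerivAt {g g' : ℝ → ℝ} {a C : ℝ} {k : ℕ} (hC : 0 ≤ C)
    (h0 : g 0 = 0) (hd : ∀ u ∈ Set.Icc 0 a, HasDerivAt g (g' u) u)
    (hb : ∀ u ∈ Set.Icc 0 a, |g' u| ≤ C * u ^ k) :
    ∀ u ∈ Set.Icc 0 a, |g u| ≤ C * u ^ (k + 1) := by
  intro u hu
  have hsub : Set.Icc 0 u ⊆ Set.Icc 0 a := Set.Icc_subset_Icc_right hu.2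
  have := Convex.norm_image_sub_le_of_norm_hasDerivWithin_le (f := g) (f' := g')
    (s := Set.Icc 0 u) (C := C * u ^ k) (x := 0) (y := u)
    (fun w hw => (hd w (hsub hw)).hasDerivWithinAt)
    (fun w hw => (hb w (hsub hw)).trans (by
      have := hw.1
      have := hw.2
      gcongr))
    (convex_Icc _ _) ⟨le_rfl, hu.1⟩ ⟨hu.1, le_rfl⟩
  rw [h0, sub_zero, sub_zero, Real.norm_eq_abs, Real.norm_eq_abs, abs_of_nonneg hu.1] at this
  rwa [pow_succ, ← mul_assoc]

section CGF

variable {μ : Measure ℝ}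

lemma hasDerivAt_iteratedDeriv_cgf {h : ℝ} (hh : h ∈ interior (integrableExpSet id μ)) (k : ℕ) :
    HasDerivAt (iteratedDeriv k (cgf id μ)) (iteratedDeriv (k + 1) (cgf id μ) h) h := by
  have ha : AnalyticAt ℝ (iteratedDeriv k (cgf id μ)) h := by
    rw [iteratedDeriv_eq_iterate]
    exact (analyticOnNhd_cgf (X := id) (μ := μ)).iterated_deriv k h hh
  rw [iteratedDeriv_succ]
  exact ha.differentiableAt.hasDerivAt

variable [IsProbabilityMeasure μ]

lemma iteratedDeriv_two_cgf_zero (h0 : (0 : ℝ) ∈ interior (integrableExpSet id μ))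
    (hmean : ∫ y, y ∂μ = 0) : iteratedDeriv 2 (cgf id μ) 0 = ∫ y, y ^ 2 ∂μ := by
  rw [iteratedDeriv_two_cgf h0, deriv_cgf_zero h0]
  simp [hmean]

/-- The third cumulant of a centered law is its third moment. -/
lemma iteratedDeriv_three_cgf_zero (h0 : (0 : ℝ) ∈ interior (integrableExpSet id μ))
    (hmean : ∫ y, y ∂μ = 0) : iteratedDeriv 3 (cgf id μ) 0 = ∫ y, y ^ 3 ∂μ := by
  have hd1 : HasDerivAt (deriv (cgf id μ)) (iteratedDeriv 2 (cgf id μ) 0) 0 := by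
    have := hasDerivAt_iteratedDeriv_cgf h0 1
    rwa [iteratedDeriv_one] at this
  have hM0 := hasDerivAt_mgf (X := id) (μ := μ) h0
  have hM2 := hasDerivAt_integral_pow_mul_exp_real (X := id) (μ := μ) h0 2
  have hq := (hM2.div hM0 (by simp)).sub (hd1.pow 2)
  have he : iteratedDeriv 2 (cgf id μ) =ᶠ[nhds 0]
      fun t => (μ[fun ω => id ω ^ 2 * Real.exp (t * id ω)]) / mgf id μ t
        - deriv (cgf id μ) t ^ 2 := by
    filter_upwards [isOpen_interior.mem_nhds h0] with t ht
    exact iteratedDeriv_two_cgf ht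
  have hu := (hasDerivAt_iteratedDeriv_cgf h0 2).unique (hq.congr_of_eventuallyEq he)
  rw [hu, deriv_cgf_zero h0]
  simp [hmean]

/-- Expansions at the origin of the cumulant generating function, the mean and the variance of the
tilted laws. -/
lemma exists_cgf_expansion (h0 : (0 : ℝ) ∈ interior (integrableExpSet id μ))
    (hmean : ∫ y, y ∂μ = 0) :
    ∃ a C : ℝ, 0 < a ∧ 0 ≤ C ∧ ∀ u ∈ Set.Icc 0 a, u ∈ interior (integrableExpSet id μ) ∧
      |cgf id μ u - (∫ y, y ^ 2 ∂μ) * u ^ 2 / 2 - (∫ y, y ^ 3 ∂μ) * u ^ 3 / 6| ≤ C * u ^ 4 ∧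
      |deriv (cgf id μ) u - (∫ y, y ^ 2 ∂μ) * u - (∫ y, y ^ 3 ∂μ) * u ^ 2 / 2| ≤ C * u ^ 3 ∧
      |iteratedDeriv 2 (cgf id μ) u - ∫ y, y ^ 2 ∂μ - (∫ y, y ^ 3 ∂μ) * u| ≤ C * u ^ 2 := by
  set s := ∫ y, y ^ 2 ∂μ with hs
  set κ := ∫ y, y ^ 3 ∂μ with hκ
  have hO := (hasDerivAt_iteratedDeriv_cgf h0 3).isBigO_sub
  obtain ⟨C, hC⟩ := hO.bound
  obtain ⟨a, ha0, ha⟩ := Metric.eventually_nhds_iff_ball.1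
    (hC.and (isOpen_interior.eventually_mem h0))
  have hC' : ∀ u ∈ Set.Icc 0 (a / 2), u ∈ interior (integrableExpSet id μ) ∧
      |iteratedDeriv 3 (cgf id μ) u - κ| ≤ |C| * u ^ 1 := by
    intro u hu
    obtain ⟨h1, h2⟩ := ha u (by
      rw [Metric.mem_ball, Real.dist_eq, sub_zero, abs_of_nonneg hu.1]
      linarith [hu.2])
    refine ⟨h2, ?_⟩
    rw [iteratedDeriv_three_cgf_zero h0 hmean, sub_zero, Real.norm_eq_abs, Real.norm_eq_abs,
      abs_of_nonneg hu.1] at h1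
    rw [pow_one]
    exact h1.trans (mul_le_mul_of_nonneg_right (le_abs_self C) hu.1)
  have b2 := abs_le_mul_pow_succ_of_hasDerivAt
    (g := fun u => iteratedDeriv 2 (cgf id μ) u - s - κ * u) (abs_nonneg C)
    (by simp [iteratedDeriv_two_cgf_zero h0 hmean, hs])
    (fun u hu => (((hasDerivAt_iteratedDeriv_cgf (hC' u hu).1 2).sub_const s).sub
      ((hasDerivAt_id u).const_mul κ)).congr_deriv (by simp))
    (fun u hu => (hC' u hu).2)
  have b1 := abs_le_mul_pow_succ_of_hasDerivAt
    (g := fun u => deriv (cgf id μ) u - s * u - κ * u ^ 2 / 2) (abs_nonneg C)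
    (by simp [deriv_cgf_zero h0, hmean])
    (fun u hu => by
      have := hasDerivAt_iteratedDeriv_cgf (hC' u hu).1 1
      rw [iteratedDeriv_one] at this
      exact ((this.sub ((hasDerivAt_id u).const_mul s)).sub
        (((hasDerivAt_pow 2 u).const_mul κ).div_const 2)).congr_deriv (by norm_num; ring))
    b2
  have b0 := abs_le_mul_pow_succ_of_hasDerivAt
    (g := fun u => cgf id μ u - s * u ^ 2 / 2 - κ * u ^ 3 / 6) (abs_nonneg C)
    (by simp)
    (fun u hu => by
      have := hasDerivAt_iteratedDeriv_cgf (hC' u hu).1 0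
      rw [iteratedDeriv_zero, zero_add, iteratedDeriv_one] at this
      exact ((this.sub (((hasDerivAt_pow 2 u).const_mul s).div_const 2)).sub
        (((hasDerivAt_pow 3 u).const_mul κ).div_const 6)).congr_deriv (by norm_num; ring))
    b1
  exact ⟨a / 2, |C|, by positivity, abs_nonneg C, fun u hu =>
    ⟨(hC' u hu).1, b0 u hu, b1 u hu, b2 u hu⟩⟩

/-- The third absolute central moments of the tilted laws are bounded near the origin. -/
lemma exists_tilted_third_moment_le {a : ℝ} (ha0 : 0 ≤ a)
    (ha : Set.Icc 0 a ⊆ interior (integrableExpSet id μ)) :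
    ∃ L : ℝ, 0 ≤ L ∧ ∀ u ∈ Set.Icc 0 a,
      ∫ y, |y - deriv (cgf id μ) u| ^ 3 ∂(μ.tilted fun y => u * y) ≤ L := by
  have hcont : ContinuousOn (cgf id μ) (Set.Icc 0 a) :=
    (analyticOnNhd_cgf (X := id) (μ := μ)).continuousOn.mono ha
  have hcont' : ContinuousOn (deriv (cgf id μ)) (Set.Icc 0 a) :=
    (analyticOnNhd_cgf (X := id) (μ := μ)).deriv.continuousOn.mono ha
  obtain ⟨A, hA⟩ := isCompact_Icc.exists_bound_of_continuousOn hcont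
  obtain ⟨B, hB⟩ := isCompact_Icc.exists_bound_of_continuousOn hcont'
  have hA0 := hA 0 ⟨le_rfl, ha0⟩
  have hB0 : 0 ≤ B := (norm_nonneg _).trans (hB 0 ⟨le_rfl, ha0⟩)
  have i0 := integrable_pow_abs_mul_exp_of_mem_interior_integrableExpSet (X := id)
    (ha ⟨le_rfl, ha0⟩) 3
  have ia := integrable_pow_abs_mul_exp_of_mem_interior_integrableExpSet (X := id)
    (ha ⟨ha0, le_rfl⟩) 3
  simp only [id, zero_mul, Real.exp_zero, mul_one] at i0 ia
  set W := ∫ y, (|y| ^ 3 + |y| ^ 3 * Real.exp (a * y)) ∂μ with hW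
  have hW0 : 0 ≤ W := integral_nonneg fun y => by positivity
  refine ⟨4 * (Real.exp A * W + B ^ 3), by positivity, fun u hu => ?_⟩
  have hi : Integrable (fun y => Real.exp (u * y)) μ :=
    interior_subset (s := integrableExpSet id μ) (ha hu)
  have hp : IsProbabilityMeasure (μ.tilted fun y => u * y) := isProbabilityMeasure_tilted hi
  have hm : |deriv (cgf id μ) u| ≤ B := hB u hu
  have iu : Integrable (fun y => |y| ^ 3) (μ.tilted fun y => u * y) := by
    simpa using (memLp_tilted_mul (X := id) (ha hu) 3).integrable_norm_pow (p := 3) (by norm_num)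
  have h1 : ∫ y, |y| ^ 3 ∂(μ.tilted fun y => u * y) ≤ Real.exp A * W := by
    have e := integral_tilted_mul_eq_cgf (X := id) (μ := μ) (t := u) (fun y => |y| ^ 3) hi
    simp only [id, smul_eq_mul] at e
    rw [e, hW, ← integral_const_mul]
    refine integral_mono_of_nonneg (ae_of_all _ fun y => by positivity)
      ((i0.add ia).const_mul _) (ae_of_all _ fun y => ?_)
    simp only
    have e1 : Real.exp (u * y) ≤ 1 + Real.exp (a * y) := by
      rcases le_total 0 y with hy | hy
      · have : Real.exp (u * y) ≤ Real.exp (a * y) :=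
          Real.exp_le_exp.2 (mul_le_mul_of_nonneg_right hu.2 hy)
        linarith
      · have : Real.exp (u * y) ≤ 1 :=
          Real.exp_le_one_iff.2 (mul_nonpos_of_nonneg_of_nonpos hu.1 hy)
        linarith [Real.exp_pos (a * y)]
    have e2 : Real.exp (-cgf id μ u) ≤ Real.exp A :=
      Real.exp_le_exp.2 ((neg_le_abs _).trans (hA u hu))
    calc Real.exp (u * y - cgf id μ u) * |y| ^ 3
        = Real.exp (-cgf id μ u) * (|y| ^ 3 * Real.exp (u * y)) := by
          rw [sub_eq_add_neg, Real.exp_add]; ring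
      _ ≤ Real.exp A * (|y| ^ 3 * (1 + Real.exp (a * y))) := by gcongr
      _ = _ := by ring
  have h2 : ∀ y, |y - deriv (cgf id μ) u| ^ 3 ≤ 4 * (|y| ^ 3 + B ^ 3) := fun y => by
    have e1 : |y - deriv (cgf id μ) u| ≤ |y| + B := (abs_sub _ _).trans (by linarith)
    have hy := abs_nonneg y
    calc |y - deriv (cgf id μ) u| ^ 3 ≤ (|y| + B) ^ 3 := by gcongr
      _ ≤ 4 * (|y| ^ 3 + B ^ 3) := by
        nlinarith [mul_nonneg (add_nonneg hy hB0) (sq_nonneg (|y| - B))]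
  have h3 : ∫ y, 4 * (|y| ^ 3 + B ^ 3) ∂(μ.tilted fun y => u * y) =
      4 * (∫ y, |y| ^ 3 ∂(μ.tilted fun y => u * y) + B ^ 3) := by
    rw [integral_const_mul, integral_add iu (integrable_const _)]
    simp
  have h4 : ∫ y, |y - deriv (cgf id μ) u| ^ 3 ∂(μ.tilted fun y => u * y) ≤
      ∫ y, 4 * (|y| ^ 3 + B ^ 3) ∂(μ.tilted fun y => u * y) :=
    integral_mono_of_nonneg (ae_of_all _ fun y => by positivity)
      ((iu.add (integrable_const _)).const_mul 4) (ae_of_all _ h2)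
  linarith

end CGF

/-! ### Moderate deviations -/

/-- The three sources of error, put together: the Berry–Esseen error `hp` under the tilted law, the
shift `hQ'` of the argument of the Gaussian tail, and the error `h1` in the exponent. -/
lemma abs_ratio_mul_exp_sub_one_le {p Q Q' E₀ E₁ E₂ x n q c₁ c₂ c₃ T M : ℝ} (hx : 0 < x)
    (hn : 0 < n) (hq : 0 < q) (hc₁ : 0 ≤ c₁) (hc₂ : 0 ≤ c₂) (hc₃ : 0 ≤ c₃) (hT : 0 ≤ T)
    (hM : x ^ 4 / n ≤ M) (hQ : q * (Real.exp (-x ^ 2 / 2) / (1 + x)) ≤ Q)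
    (h1 : |E₁ - E₀| ≤ c₁ * (x ^ 4 / n)) (h2 : |E₂ - (E₀ - x ^ 2 / 2)| ≤ c₂ * (x ^ 4 / n))
    (hQ' : |Q' - Q| ≤ c₃ * (x ^ 3 / n) * Real.exp (-x ^ 2 / 2 + c₃ * (x ^ 4 / n)))
    (hp : |p - Real.exp E₁ * Q'| ≤ Real.exp E₂ * T / √n) :
    |p / Q * Real.exp (-E₀) - 1| ≤
      (Real.exp (c₂ * M) * T / q + Real.exp (c₁ * M) * Real.exp (c₃ * M) * c₃ / q
        + c₁ * Real.exp (c₁ * M)) * ((1 + x) ^ 4 / n + (1 + x) / √n) := by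
  have hg : 0 < Real.exp (-x ^ 2 / 2) := Real.exp_pos _
  have hQ0 : 0 < Q := lt_of_lt_of_le (by positivity) hQ
  have hs : 0 < √n := Real.sqrt_pos.2 hn
  have hgQ : Real.exp (-x ^ 2 / 2) / Q ≤ (1 + x) / q := by
    rw [div_le_div_iff₀ hQ0 hq]
    have := mul_le_mul_of_nonneg_left hQ (by positivity : 0 ≤ 1 + x)
    calc Real.exp (-x ^ 2 / 2) * q = (1 + x) * (q * (Real.exp (-x ^ 2 / 2) / (1 + x))) := by
          field_simp
      _ ≤ _ := this
  have hM1 : c₁ * (x ^ 4 / n) ≤ c₁ * M := by gcongr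
  have hM2 : c₂ * (x ^ 4 / n) ≤ c₂ * M := by gcongr
  have hM3 : c₃ * (x ^ 4 / n) ≤ c₃ * M := by gcongr
  have e : p / Q * Real.exp (-E₀) - 1 = (p - Real.exp E₁ * Q') * Real.exp (-E₀) / Q
      + Real.exp (E₁ - E₀) * ((Q' - Q) / Q) + (Real.exp (E₁ - E₀) - 1) := by
    rw [sub_eq_add_neg E₁, Real.exp_add]
    field_simp
    ring
  have t1 : |(p - Real.exp E₁ * Q') * Real.exp (-E₀) / Q| ≤
      Real.exp (c₂ * M) * T / q * ((1 + x) / √n) := by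
    rw [abs_div, abs_mul, Real.abs_exp, abs_of_pos hQ0]
    have e2 : Real.exp E₂ * Real.exp (-E₀) ≤ Real.exp (c₂ * M) * Real.exp (-x ^ 2 / 2) := by
      rw [← Real.exp_add, ← Real.exp_add, Real.exp_le_exp]
      linarith [(abs_le.1 h2).2]
    calc |p - Real.exp E₁ * Q'| * Real.exp (-E₀) / Q
        ≤ Real.exp E₂ * T / √n * Real.exp (-E₀) / Q := by gcongr
      _ = (Real.exp E₂ * Real.exp (-E₀)) * (T / √n / Q) := by ring
      _ ≤ (Real.exp (c₂ * M) * Real.exp (-x ^ 2 / 2)) * (T / √n / Q) := by gcongr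
      _ = Real.exp (c₂ * M) * T / √n * (Real.exp (-x ^ 2 / 2) / Q) := by ring
      _ ≤ Real.exp (c₂ * M) * T / √n * ((1 + x) / q) := by gcongr
      _ = _ := by ring
  have t2 : |Real.exp (E₁ - E₀) * ((Q' - Q) / Q)| ≤
      Real.exp (c₁ * M) * Real.exp (c₃ * M) * c₃ / q * ((1 + x) ^ 4 / n) := by
    rw [abs_mul, Real.abs_exp, abs_div, abs_of_pos hQ0]
    have e1 : Real.exp (E₁ - E₀) ≤ Real.exp (c₁ * M) := by
      gcongr
      linarith [(abs_le.1 h1).2]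
    have e3 : Real.exp (-x ^ 2 / 2 + c₃ * (x ^ 4 / n)) ≤
        Real.exp (c₃ * M) * Real.exp (-x ^ 2 / 2) := by
      rw [← Real.exp_add, Real.exp_le_exp]
      linarith
    calc Real.exp (E₁ - E₀) * (|Q' - Q| / Q)
        ≤ Real.exp (c₁ * M) * (c₃ * (x ^ 3 / n) * (Real.exp (c₃ * M) * Real.exp (-x ^ 2 / 2)) / Q) := by
          gcongr
          exact hQ'.trans (by gcongr)
      _ = Real.exp (c₁ * M) * Real.exp (c₃ * M) * c₃ * (x ^ 3 / n) *
          (Real.exp (-x ^ 2 / 2) / Q) := by ring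
      _ ≤ Real.exp (c₁ * M) * Real.exp (c₃ * M) * c₃ * ((1 + x) ^ 3 / n) * ((1 + x) / q) := by
          gcongr
          linarith
      _ = _ := by ring
  have t3 : |Real.exp (E₁ - E₀) - 1| ≤ c₁ * Real.exp (c₁ * M) * ((1 + x) ^ 4 / n) := by
    have e1 : |Real.exp (E₁ - E₀) - 1| ≤ |E₁ - E₀| * Real.exp |E₁ - E₀| := by
      have e2 := Complex.norm_exp_sub_sum_le_norm_mul_exp (E₁ - E₀ : ℝ) 1
      rw [← Complex.ofReal_exp] at e2
      simp only [Finset.range_one, Finset.sum_singleton, pow_zero, Nat.factorial_zero,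
        Nat.cast_one, div_one, pow_one, Complex.norm_real, Real.norm_eq_abs] at e2
      rwa [← Complex.ofReal_one, ← Complex.ofReal_sub, Complex.norm_real, Real.norm_eq_abs] at e2
    calc |Real.exp (E₁ - E₀) - 1| ≤ |E₁ - E₀| * Real.exp |E₁ - E₀| := e1
      _ ≤ (c₁ * (x ^ 4 / n)) * Real.exp (c₁ * M) := by
          gcongr
          exact h1.trans hM1
      _ ≤ (c₁ * ((1 + x) ^ 4 / n)) * Real.exp (c₁ * M) := by
          gcongr
          linarith
      _ = _ := by ring
  rw [e]
  refine (abs_add_three _ _ _).trans ?_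
  have p1 : 0 ≤ Real.exp (c₂ * M) * T / q * ((1 + x) ^ 4 / n) := by positivity
  have p2 : 0 ≤ Real.exp (c₁ * M) * Real.exp (c₃ * M) * c₃ / q * ((1 + x) / √n) := by positivity
  have p3 : 0 ≤ c₁ * Real.exp (c₁ * M) * ((1 + x) / √n) := by positivity
  linarith

/-- The standardized end point `(x σ √n - n m + n v h) / √(n v)`, for the tilt `h = x / (σ √n)`,
differs from `x = h σ √n` by a term of third order in `h`: the terms of first and second order
cancel. -/
lemma abs_endpoint_sub_le {σ κ C h m v R : ℝ} (hσ : 0 < σ) (hC : 0 ≤ C) (hh : 0 < h)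
    (hh1 : h ≤ 1) (hR : 0 < R) (hv : σ ^ 2 / 4 ≤ v)
    (hmh : |m - σ ^ 2 * h - κ * h ^ 2 / 2| ≤ C * h ^ 3) (hvh : |v - σ ^ 2 - κ * h| ≤ C * h ^ 2) :
    |(h * σ ^ 2 * R ^ 2 - R ^ 2 * m + R ^ 2 * v * h) / (√v * R) - h * σ * R| ≤
      2 / σ * ((|κ| + C) ^ 2 / (2 * σ ^ 2) + 3 * C / 2) * (R * h ^ 3) := by
  have hv0 : 0 < v := lt_of_lt_of_le (by positivity) hv
  set w := √v with hw
  have hw0 : 0 < w := Real.sqrt_pos.2 hv0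
  have hww : w ^ 2 = v := Real.sq_sqrt hv0.le
  have hwσ : σ / 2 ≤ w := Real.le_sqrt_of_sq_le (by linarith [show (σ / 2) ^ 2 = σ ^ 2 / 4 by ring])
  have e : (h * σ ^ 2 * R ^ 2 - R ^ 2 * m + R ^ 2 * v * h) / (w * R) - h * σ * R =
      1 / w * (h * (w - σ) ^ 2 / 2 + (h / 2 * (v - σ ^ 2 - κ * h)
        - (m - σ ^ 2 * h - κ * h ^ 2 / 2))) * R := by
    rw [← hww]
    field_simp
    ring
  have a1 : |v - σ ^ 2| ≤ (|κ| + C) * h := by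
    have e1 : v - σ ^ 2 = (v - σ ^ 2 - κ * h) + κ * h := by ring
    rw [e1]
    refine (abs_add_le _ _).trans ?_
    rw [abs_mul, abs_of_pos hh]
    nlinarith [mul_nonneg (mul_nonneg hC hh.le) (sub_nonneg.2 hh1)]
  have a2 : |w - σ| ≤ (|κ| + C) * h / σ := by
    rw [le_div_iff₀ hσ]
    calc |w - σ| * σ ≤ |w - σ| * (w + σ) := by gcongr; linarith
      _ = |v - σ ^ 2| := by
        rw [show v - σ ^ 2 = (w - σ) * (w + σ) by rw [← hww]; ring, abs_mul,
          abs_of_pos (by positivity : 0 < w + σ)]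
      _ ≤ _ := a1
  have a3 : (w - σ) ^ 2 ≤ ((|κ| + C) * h / σ) ^ 2 := by
    rw [← sq_abs (w - σ)]; gcongr
  have a4 : |h * (w - σ) ^ 2 / 2 + (h / 2 * (v - σ ^ 2 - κ * h)
        - (m - σ ^ 2 * h - κ * h ^ 2 / 2))| ≤
      ((|κ| + C) ^ 2 / (2 * σ ^ 2) + 3 * C / 2) * h ^ 3 := by
    have b1 : |h * (w - σ) ^ 2 / 2| ≤ (|κ| + C) ^ 2 / (2 * σ ^ 2) * h ^ 3 := by
      rw [abs_of_nonneg (by positivity)]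
      calc h * (w - σ) ^ 2 / 2 ≤ h * ((|κ| + C) * h / σ) ^ 2 / 2 := by gcongr
        _ = _ := by field_simp
    have b2 : |h / 2 * (v - σ ^ 2 - κ * h)| ≤ C / 2 * h ^ 3 := by
      rw [abs_mul, abs_of_pos (by positivity)]
      calc h / 2 * |v - σ ^ 2 - κ * h| ≤ h / 2 * (C * h ^ 2) := by gcongr
        _ = _ := by ring
    refine (abs_add_le _ _).trans ((add_le_add b1 ((abs_sub _ _).trans (add_le_add b2 hmh))).trans
      (le_of_eq ?_))
    ring
  rw [e, abs_mul, abs_mul, abs_of_pos hR, abs_of_pos (by positivity : 0 < 1 / w)]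
  have a5 : 1 / w ≤ 2 / σ := by
    rw [div_le_div_iff₀ hw0 hσ]; linarith
  calc _ ≤ 2 / σ * (((|κ| + C) ^ 2 / (2 * σ ^ 2) + 3 * C / 2) * h ^ 3) * R := by gcongr
    _ = _ := by ring

/-- For the tilt `h`, the exponent coming from the change of measure and the Gaussian integral is
`n κ h ^ 3 / 6` up to a term of fourth order: the terms of second order cancel. -/
lemma abs_exponent_sub_le {σ κ C h ψ m v R : ℝ} (hh : 0 < h)
    (hψh : |ψ - σ ^ 2 * h ^ 2 / 2 - κ * h ^ 3 / 6| ≤ C * h ^ 4)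
    (hmh : |m - σ ^ 2 * h - κ * h ^ 2 / 2| ≤ C * h ^ 3) (hvh : |v - σ ^ 2 - κ * h| ≤ C * h ^ 2) :
    |R ^ 2 * ψ - h * (R ^ 2 * m) + R ^ 2 * v * h ^ 2 / 2 - R ^ 2 * (κ * h ^ 3 / 6)| ≤
      5 / 2 * C * (R ^ 2 * h ^ 4) := by
  have e : R ^ 2 * ψ - h * (R ^ 2 * m) + R ^ 2 * v * h ^ 2 / 2 - R ^ 2 * (κ * h ^ 3 / 6) =
      R ^ 2 * ((ψ - σ ^ 2 * h ^ 2 / 2 - κ * h ^ 3 / 6) - h * (m - σ ^ 2 * h - κ * h ^ 2 / 2)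
        + h ^ 2 / 2 * (v - σ ^ 2 - κ * h)) := by ring
  rw [e, abs_mul, abs_of_nonneg (sq_nonneg R)]
  have b1 : |h * (m - σ ^ 2 * h - κ * h ^ 2 / 2)| ≤ C * h ^ 4 := by
    rw [abs_mul, abs_of_pos hh]
    calc h * |m - σ ^ 2 * h - κ * h ^ 2 / 2| ≤ h * (C * h ^ 3) := by gcongr
      _ = _ := by ring
  have b2 : |h ^ 2 / 2 * (v - σ ^ 2 - κ * h)| ≤ C * h ^ 4 / 2 := by
    rw [abs_mul, abs_of_pos (by positivity)]
    calc h ^ 2 / 2 * |v - σ ^ 2 - κ * h| ≤ h ^ 2 / 2 * (C * h ^ 2) := by gcongr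
      _ = _ := by ring
  have b3 := (abs_add_le (ψ - σ ^ 2 * h ^ 2 / 2 - κ * h ^ 3 / 6 -
      h * (m - σ ^ 2 * h - κ * h ^ 2 / 2)) (h ^ 2 / 2 * (v - σ ^ 2 - κ * h))).trans
    (add_le_add ((abs_sub _ _).trans (add_le_add hψh b1)) b2)
  calc _ ≤ R ^ 2 * (C * h ^ 4 + C * h ^ 4 + C * h ^ 4 / 2) :=
        mul_le_mul_of_nonneg_left b3 (sq_nonneg R)
    _ = _ := by ring

lemma sq_div_four_le_of_expansion {σ κ C h v : ℝ} (hC : 0 ≤ C) (hh : 0 < h) (hh1 : h ≤ 1)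
    (hha : h ≤ σ ^ 2 / (2 * (|κ| + C + 1))) (hvh : |v - σ ^ 2 - κ * h| ≤ C * h ^ 2) :
    σ ^ 2 / 4 ≤ v := by
  have hha2 : h * (2 * (|κ| + C + 1)) ≤ σ ^ 2 := by
    rwa [← le_div_iff₀ (by positivity)]
  have hκh : -(|κ| * h) ≤ κ * h := by
    rw [← neg_mul]; exact mul_le_mul_of_nonneg_right (neg_abs_le κ) hh.le
  nlinarith [(abs_le.1 hvh).1, mul_nonneg (mul_nonneg hC hh.le) (sub_nonneg.2 hh1), sq_nonneg σ]

section ModerateDeviations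

/-- The estimate for a single tilt `h`, given the expansions at `h` of the cumulant generating
function, of the mean `m` and of the variance `v` of the tilted law. -/
lemma abs_ratio_sub_one_le_of_expansion (μ : Measure ℝ) [IsProbabilityMeasure μ]
    {σ κ C h ψ m v L M x : ℝ} (hσ : 0 < σ) (hC : 0 ≤ C) (hL0 : 0 ≤ L) (hh : 0 < h) (hh1 : h ≤ 1)
    (hmem : h ∈ interior (integrableExpSet id μ)) (hψ : cgf id μ h = ψ)
    (hm : deriv (cgf id μ) h = m) (hv : iteratedDeriv 2 (cgf id μ) h = v)
    (hψh : |ψ - σ ^ 2 * h ^ 2 / 2 - κ * h ^ 3 / 6| ≤ C * h ^ 4)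
    (hmh : |m - σ ^ 2 * h - κ * h ^ 2 / 2| ≤ C * h ^ 3) (hvh : |v - σ ^ 2 - κ * h| ≤ C * h ^ 2)
    (hvσ : σ ^ 2 / 4 ≤ v) (hL : ∫ y, |y - m| ^ 3 ∂(μ.tilted fun y => h * y) ≤ L) {n : ℕ}
    (hn : 1 ≤ n) (hxh : x = h * σ * √n) (hM : x ^ 4 / n ≤ M) {q c₃ : ℝ}
    (hq : q = (√(2 * Real.pi))⁻¹ * Real.exp (-3 / 2))
    (hc₃ : c₃ = 2 / σ * ((|κ| + C) ^ 2 / (2 * σ ^ 2) + 3 * C / 2)) :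
    |(iidSum μ n).real (Set.Ioi (x * σ * √n)) / (gaussianReal 0 1).real (Set.Ioi x) *
        Real.exp (-(x ^ 3 * κ / (6 * σ ^ 3 * √n))) - 1| ≤
      (Real.exp (C / σ ^ 4 * M) * (152 * (L / (σ / 2) ^ 3)) / q +
        Real.exp (5 / 2 * C / σ ^ 4 * M) * Real.exp (c₃ / σ ^ 3 * M) * (c₃ / σ ^ 3) / q +
        5 / 2 * C / σ ^ 4 * Real.exp (5 / 2 * C / σ ^ 4 * M)) *
      ((1 + x) ^ 4 / n + (1 + x) / √n) := by
  have hq0 : 0 < q := by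
    have := one_le_sqrt_two_pi
    rw [hq]
    positivity
  have hc₃0 : 0 ≤ c₃ := by rw [hc₃]; positivity
  have hn0 : (1 : ℝ) ≤ n := by exact_mod_cast hn
  have hR0 : 0 < √(n : ℝ) := Real.sqrt_pos.2 (by linarith)
  have hRR : (n : ℝ) = √(n : ℝ) ^ 2 := (Real.sq_sqrt (by linarith)).symm
  have hx : 0 < x := by rw [hxh]; positivity
  have hv0 : 0 < v := lt_of_lt_of_le (by positivity) hvσ
  have hw : σ / 2 ≤ √v :=
    Real.le_sqrt_of_sq_le (by linarith [show (σ / 2) ^ 2 = σ ^ 2 / 4 by ring])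
  have key := abs_iidSum_real_Ioi_sub_le μ hh hmem hm hv hv0 hL hn (x * σ * √(n : ℝ))
  rw [hψ] at key
  have eE : x ^ 3 * κ / (6 * σ ^ 3 * √(n : ℝ)) = √(n : ℝ) ^ 2 * (κ * h ^ 3 / 6) := by
    rw [hxh]; field_simp
  have e4 : √(n : ℝ) ^ 2 * h ^ 4 = x ^ 4 / n / σ ^ 4 := by
    rw [hRR, hxh]; simp only [Real.sqrt_sq hR0.le]; field_simp
  have e3 : √(n : ℝ) * h ^ 3 = x ^ 3 / n / σ ^ 3 := by
    rw [hRR, hxh]; simp only [Real.sqrt_sq hR0.le]; field_simp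
  refine abs_ratio_mul_exp_sub_one_le hx (by linarith) hq0 (by positivity) (by positivity)
    (by positivity) (by positivity) hM (hq ▸ le_gaussianReal_real_Ioi hx.le)
    (E₁ := n * ψ - h * (n * m) + n * v * h ^ 2 / 2) (E₂ := n * ψ - h * (x * σ * √(n : ℝ)))
    (Q' := (gaussianReal 0 1).real (Set.Ioi ((x * σ * √(n : ℝ) - n * m + n * v * h) /
      (√v * √(n : ℝ))))) ?_ ?_ ?_ ?_
  · have := abs_exponent_sub_le (R := √(n : ℝ)) hh hψh hmh hvh
    rw [e4, ← hRR] at this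
    rw [eE, ← hRR]
    exact this.trans (le_of_eq (by ring))
  · have e : n * ψ - h * (x * σ * √(n : ℝ)) - (x ^ 3 * κ / (6 * σ ^ 3 * √(n : ℝ)) - x ^ 2 / 2) =
        √(n : ℝ) ^ 2 * (ψ - σ ^ 2 * h ^ 2 / 2 - κ * h ^ 3 / 6) := by
      rw [eE, hxh]
      linear_combination ψ * hRR
    rw [e, abs_mul, abs_of_pos (by positivity : 0 < √(n : ℝ) ^ 2)]
    calc _ ≤ √(n : ℝ) ^ 2 * (C * h ^ 4) := by gcongr
      _ = C * (√(n : ℝ) ^ 2 * h ^ 4) := by ring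
      _ = _ := by rw [e4]; ring
  · have hd := abs_endpoint_sub_le hσ hC hh hh1 hR0 hvσ hmh hvh
    have e1 : x * σ * √(n : ℝ) - n * m + n * v * h =
        h * σ ^ 2 * √(n : ℝ) ^ 2 - √(n : ℝ) ^ 2 * m + √(n : ℝ) ^ 2 * v * h := by
      rw [hxh]
      linear_combination (v * h - m) * hRR
    have e2 : c₃ * (√(n : ℝ) * h ^ 3) = c₃ / σ ^ 3 * (x ^ 3 / n) := by
      rw [e3]; ring
    rw [← hxh, ← hc₃, e2, ← e1] at hd
    have e5 : c₃ / σ ^ 3 * (x ^ 4 / n) = x * (c₃ / σ ^ 3 * (x ^ 3 / n)) := by ring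
    rw [e5]
    refine (abs_gaussianReal_real_Ioi_sub_le hx.le).trans ?_
    exact mul_le_mul hd (Real.exp_le_exp.2 (by gcongr)) (Real.exp_pos _).le (by positivity)
  · refine key.trans ?_
    rw [← mul_div_assoc]
    gcongr

variable {μ : Measure ℝ} [IsProbabilityMeasure μ] {σ : ℝ}

/-- The estimate for tilts `h = x / (σ √n)` in a neighbourhood of the origin. -/
lemma exists_abs_ratio_sub_one_le_of_le (hσ : 0 < σ) (hmean : ∫ y, y ∂μ = 0)
    (hvar : ∫ y, y ^ 2 ∂μ = σ ^ 2) (h0 : (0 : ℝ) ∈ interior (integrableExpSet id μ)) (M : ℝ) :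
    ∃ a B : ℝ, 0 < a ∧ ∀ (n : ℕ) (x : ℝ), 1 ≤ n → 0 < x → x ^ 4 / n ≤ M → x ≤ a * (σ * √n) →
      |(iidSum μ n).real (Set.Ioi (x * σ * √n)) / (gaussianReal 0 1).real (Set.Ioi x) *
          Real.exp (-(x ^ 3 * (∫ y, y ^ 3 ∂μ) / (6 * σ ^ 3 * √n))) - 1| ≤
        B * ((1 + x) ^ 4 / n + (1 + x) / √n) := by
  obtain ⟨a₀, C, ha₀, hC, hexp⟩ := exists_cgf_expansion h0 hmean
  obtain ⟨L, hL0, hL⟩ := exists_tilted_third_moment_le ha₀.le fun u hu => (hexp u hu).1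
  rw [hvar] at hexp
  obtain ⟨q, hq⟩ : ∃ q, q = (√(2 * Real.pi))⁻¹ * Real.exp (-3 / 2) := ⟨_, rfl⟩
  obtain ⟨c₃, hc₃⟩ : ∃ c₃, c₃ =
    2 / σ * ((|∫ y, y ^ 3 ∂μ| + C) ^ 2 / (2 * σ ^ 2) + 3 * C / 2) := ⟨_, rfl⟩
  refine ⟨min a₀ (min 1 (σ ^ 2 / (2 * (|∫ y, y ^ 3 ∂μ| + C + 1)))),
    Real.exp (C / σ ^ 4 * M) * (152 * (L / (σ / 2) ^ 3)) / q +
      Real.exp (5 / 2 * C / σ ^ 4 * M) * Real.exp (c₃ / σ ^ 3 * M) * (c₃ / σ ^ 3) / q +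
      5 / 2 * C / σ ^ 4 * Real.exp (5 / 2 * C / σ ^ 4 * M), by positivity,
    fun n x hn hx hM hxa => ?_⟩
  have hn0 : (1 : ℝ) ≤ n := by exact_mod_cast hn
  have hR0 : 0 < √(n : ℝ) := Real.sqrt_pos.2 (by linarith)
  rw [← div_le_iff₀ (by positivity), le_min_iff, le_min_iff] at hxa
  obtain ⟨hha₀, hh1, hha⟩ := hxa
  have hh0 : 0 < x / (σ * √(n : ℝ)) := by positivity
  obtain ⟨hmem, bψ, bm, bv⟩ := hexp _ ⟨hh0.le, hha₀⟩
  exact abs_ratio_sub_one_le_of_expansion μ hσ hC hL0 hh0 hh1 hmem rfl rfl rfl bψ bm bv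
    (sq_div_four_le_of_expansion hC hh0 hh1 hha bv) (hL _ ⟨hh0.le, hha₀⟩) hn (by field_simp) hM
    hq hc₃

/-- When the tilt `h = x / (σ √n)` exceeds `a`, both `x` and `n` are bounded in terms of `a`, `σ`
and `K`, so it is enough that the tail probability `p` lies in `[0, 1]`. -/
lemma exists_abs_ratio_sub_one_le_of_lt (hσ : 0 < σ) (κ : ℝ) {a : ℝ} (ha : 0 < a) {K : ℝ}
    (hK : 0 < K) :
    ∃ B : ℝ, ∀ (n : ℕ) (x p : ℝ), 1 ≤ n → 0 < x → 0 ≤ p → p ≤ 1 → x ^ 4 / n ≤ K ^ 4 →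
      a * (σ * √n) < x →
      |p / (gaussianReal 0 1).real (Set.Ioi x) * Real.exp (-(x ^ 3 * κ / (6 * σ ^ 3 * √n))) - 1| ≤
        B * ((1 + x) ^ 4 / n + (1 + x) / √n) := by
  set q := (√(2 * Real.pi))⁻¹ * Real.exp (-3 / 2) with hq
  have hq0 : 0 < q := by
    have := one_le_sqrt_two_pi
    positivity
  set Y := K ^ 2 / (a * σ) with hY
  set Z := (q * (Real.exp (-Y ^ 2 / 2) / (1 + Y)))⁻¹ * Real.exp (Y ^ 3 * |κ| / (6 * σ ^ 3)) + 1
    with hZ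
  have hY0 : 0 < Y := by positivity
  have hZ0 : 0 < Z := by positivity
  refine ⟨Z / (a * σ), fun n x p hn hx hp0 hp1 hM hxa => ?_⟩
  have hn0 : (1 : ℝ) ≤ n := by exact_mod_cast hn
  have hR1 : 1 ≤ √(n : ℝ) := Real.one_le_sqrt.2 hn0
  have hRR : (n : ℝ) = √(n : ℝ) ^ 2 := (Real.sq_sqrt (by linarith)).symm
  set R := √(n : ℝ) with hR
  have hR0 : 0 < R := by linarith
  have hxY : x ≤ Y := by
    rw [hY, le_div_iff₀ (by positivity)]
    rw [hRR, div_le_iff₀ (by positivity)] at hM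
    have h1 : x ^ 2 ≤ K ^ 2 * R := by
      refine (pow_le_pow_iff_left₀ (by positivity) (by positivity) two_ne_zero).1 ?_
      calc (x ^ 2) ^ 2 = x ^ 4 := by ring
        _ ≤ K ^ 4 * R ^ 2 := hM
        _ = _ := by ring
    nlinarith [mul_le_mul_of_nonneg_left hxa.le hx.le]
  have hQ : q * (Real.exp (-Y ^ 2 / 2) / (1 + Y)) ≤ (gaussianReal 0 1).real (Set.Ioi x) :=
    (le_gaussianReal_real_Ioi hY0.le).trans (measureReal_mono (Set.Ioi_subset_Ioi hxY))
  set Q := (gaussianReal 0 1).real (Set.Ioi x) with hQdef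
  have hqY : 0 < q * (Real.exp (-Y ^ 2 / 2) / (1 + Y)) := by positivity
  have hQ0 : 0 < Q := lt_of_lt_of_le hqY hQ
  have hE : -(x ^ 3 * κ / (6 * σ ^ 3 * R)) ≤ Y ^ 3 * |κ| / (6 * σ ^ 3) := by
    refine (neg_le_abs _).trans ?_
    rw [abs_div, abs_mul, abs_of_pos (by positivity : 0 < x ^ 3),
      abs_of_pos (by positivity : 0 < 6 * σ ^ 3 * R)]
    have : 6 * σ ^ 3 ≤ 6 * σ ^ 3 * R := le_mul_of_one_le_right (by positivity) hR1
    gcongr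
  have hS : a * σ ≤ (1 + x) ^ 4 / n + (1 + x) / R := by
    have h1 : 0 ≤ (1 + x) ^ 4 / n := by positivity
    have h2 : a * σ ≤ (1 + x) / R := by
      rw [le_div_iff₀ hR0]; linarith
    linarith
  have hb : |p / Q * Real.exp (-(x ^ 3 * κ / (6 * σ ^ 3 * R))) - 1| ≤ Z := by
    refine (abs_sub _ _).trans ?_
    rw [abs_of_nonneg (by positivity), abs_one, hZ]
    gcongr
    rw [div_eq_mul_inv]
    calc p * Q⁻¹ ≤ 1 * Q⁻¹ := by gcongr
      _ = Q⁻¹ := one_mul _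
      _ ≤ _ := by gcongr
  refine hb.trans ?_
  calc Z = Z / (a * σ) * (a * σ) := by field_simp
    _ ≤ _ := by gcongr

end ModerateDeviations

/-- `μ` is the common law of the `X i`; the constant `C` depends only on `μ` and on the constant `K`
in the range `0 < x ≤ K n ^ (1/4)`. The standard normal distribution function is
`cdf (gaussianReal 0 1)`. -/
theorem corollary2p1 (μ : Measure ℝ) [IsProbabilityMeasure μ] (σ : ℝ) (hσ : 0 < σ)
    (hmean : ∫ y, y ∂μ = 0) (hvar : ∫ y, y ^ 2 ∂μ = σ ^ 2)
    (hexp : ∃ t₀ : ℝ, 0 < t₀ ∧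
      ∀ t : ℝ, |t| ≤ t₀ → Integrable (fun y : ℝ => Real.exp (t * y)) μ) :
    ∀ K : ℝ, 0 < K → ∃ C : ℝ, 0 < C ∧
      ∀ (Ω : Type*) [MeasurableSpace Ω] (P : Measure Ω) [IsProbabilityMeasure P]
        (n : ℕ) (X : Fin n → Ω → ℝ),
        1 ≤ n → (∀ i, HasLaw (X i) μ P) → iIndepFun X P →
        ∀ x : ℝ, 0 < x → x ≤ K * (n : ℝ) ^ (1 / 4 : ℝ) →
          ∃ θ : ℝ, |θ| ≤ C ∧
            P.real {ω | x * σ * √(n : ℝ) < ∑ i, X i ω} / (1 - cdf (gaussianReal 0 1) x) =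
              Real.exp (x ^ 3 * (∫ y, y ^ 3 ∂μ) / (6 * σ ^ 3 * √(n : ℝ))) *
                (1 + θ * ((1 + x) ^ 4 / (n : ℝ) + (1 + x) / √(n : ℝ))) := by
  have h0 : (0 : ℝ) ∈ interior (integrableExpSet id μ) := by
    obtain ⟨t₀, ht₀, hint⟩ := hexp
    rw [mem_interior_iff_mem_nhds]
    filter_upwards [Metric.closedBall_mem_nhds (0 : ℝ) ht₀] with t ht
    exact hint t (by simpa using ht)
  intro K hK
  obtain ⟨a, B₁, ha, hB₁⟩ := exists_abs_ratio_sub_one_le_of_le hσ hmean hvar h0 (K ^ 4)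
  obtain ⟨B₂, hB₂⟩ := exists_abs_ratio_sub_one_le_of_lt hσ (∫ y, y ^ 3 ∂μ) ha hK
  refine ⟨|B₁| + |B₂| + 1, by positivity, ?_⟩
  intro Ω _ P _ n X hn hX hind x hx hxK
  have hn0 : (1 : ℝ) ≤ n := by exact_mod_cast hn
  have hM : x ^ 4 / n ≤ K ^ 4 := by
    rw [div_le_iff₀ (by positivity)]
    calc x ^ 4 ≤ (K * (n : ℝ) ^ (1 / 4 : ℝ)) ^ 4 := by gcongr
      _ = K ^ 4 * n := by
        rw [mul_pow, ← Real.rpow_natCast ((n : ℝ) ^ (1 / 4 : ℝ)), ← Real.rpow_mul (by positivity)]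
        norm_num
  have hlaw : P.real {ω | x * σ * √(n : ℝ) < ∑ i, X i ω} =
      (iidSum μ n).real (Set.Ioi (x * σ * √(n : ℝ))) :=
    (hasLaw_sum_iidSum μ P n X hX hind).measureReal_eq (p := fun s => x * σ * √(n : ℝ) < s)
      measurableSet_Ioi
  rw [hlaw, one_sub_cdf_eq]
  set S := (1 + x) ^ 4 / (n : ℝ) + (1 + x) / √(n : ℝ) with hS
  have hS0 : 0 < S := by positivity
  set r := (iidSum μ n).real (Set.Ioi (x * σ * √(n : ℝ))) /
    (gaussianReal 0 1).real (Set.Ioi x) with hr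
  set E := x ^ 3 * (∫ y, y ^ 3 ∂μ) / (6 * σ ^ 3 * √(n : ℝ)) with hE
  have key : |r * Real.exp (-E) - 1| ≤ (|B₁| + |B₂| + 1) * S := by
    rcases le_or_gt x (a * (σ * √(n : ℝ))) with hxa | hxa
    · refine (hB₁ n x hn hx hM hxa).trans ?_
      gcongr
      linarith [le_abs_self B₁, abs_nonneg B₂]
    · refine (hB₂ n x _ hn hx measureReal_nonneg measureReal_le_one hM hxa).trans ?_
      gcongr
      linarith [le_abs_self B₂, abs_nonneg B₁]
  refine ⟨(r * Real.exp (-E) - 1) / S, ?_, ?_⟩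
  · rw [abs_div, abs_of_pos hS0, div_le_iff₀ hS0]
    exact key
  · rw [div_mul_cancel₀ _ hS0.ne', add_sub_cancel, mul_left_comm, ← Real.exp_add]
    simp
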